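/- Let $\mathbb D$ be the open unit disk, $\mathrm{Li}_2(z)=\sum_{n\ge1}z^n/n^2$, and let $\sqrt{\cdot}$ denote the principal square root. For positive integers $k$ put $f_k(z)=\frac1k\Re\sqrt{\mathrm{Li}_2(z^k)}$ for $|z|\le1$, and $$L_k(z)=\tfrac1k\sqrt{\mathrm{Li}_2(z^k)}\ \ (k\text{ odd}),\qquad L_{2j}(z)=\tfrac1j\sqrt{\mathrm{Li}_2(-z^j)}\ \ (j\ge1).$$ *Phases.* For a sequence of functions $(L_m)_{m\ge1}$ on $\mathbb D$, consider families of pairwise disjoint open sets $R(m)\subseteq\mathbb D$, finitely many of them nonempty, whose union together with their boundaries covers $\mathbb D$, and such that $\Re L_m(z)>\Re L_k(z)$ for all $z\in R(m)$ and all $k\ne m$. The phases of $(L_m)$ are the nonempty members of a maximal such family (with respect to inclusion of each $R(m)$). *Phase functions of the odd-part partition polynomials.* These polynomials $F_n$ are given by $1+\sum_{n\ge1}F_n(z)q^n=\prod_{m\ge1}(1-zq^m)^{-a_m}$ with $a_m=1$ for $m$ odd and $a_m=0$ for $m$ even. With $e_k(x)=e^{2\pi i x/k}$, let $D_{t,k}(s)=\sum_{m\ge1}a_m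 e_k(mt)m^{-s}$, $c_k(j)=\frac1k\sum_{t=1}^k e_k(-tj)\,\mathrm{Res}(D_{t,k},s=1)$, and $L_{h,k}(z)=\sqrt{\sum_{j=1}^k c_k(j)\,\mathrm{Li}_2(e_k(jh)z)}$ for $1\le h\le k$, $\gcd(h,k)=1$. **Theorem.** For all such $h,k$ and all $z\in\mathbb D$ one has $\sqrt2\,L_{h,k}(z)=L_k(z)$, so that the phases of the odd-part partition polynomials are those of the sequence $(L_k)_{k\ge1}$ on $\mathbb D$. The equation $f_1(ir)=f_2(r)$ has exactly one solution $r=\beta$ in $(0,1]$, and $\beta<1$. Let $$\gamma=\{z\in\mathbb D\setminus\{0\}:\ \Re z\ge0,\ \Im z\ge0,\ \Re L_1(z)=\Re L_4(z)\}.$$ There is exactly one maximal family $(R(m))_{m\ge1}$ as above for the sequence $(L_k)_{k\ge1}$; exactly three of its members, $R(1)$, $R(2)$ and $R(4)$, are nonempty, and their boundaries relative to $\mathbb D$ are 1. $\partial R(4)\cap\mathbb D=\gamma\cup(-\gamma)\cup\overline\gamma\cup(-\overline\gamma)$, 2. $\partial R(1)\cap\mathbb D=i[-\beta,\beta]\cup\gamma\cup\overline\gamma$,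 3. $\partial R(2)\cap\mathbb D=i[-\beta,\beta]\cup(-\gamma)\cup(-\overline\gamma)$, where $\overline\gamma=\{\overline z:z\in\gamma\}$. -/

import Mathlib

open Set Filter Topology
open scoped Pointwise ComplexConjugate

namespace OddPartitionPhases

noncomputable section

/-- The dilogarithm `Li₂(z) = ∑_{n ≥ 1} zⁿ / n²`, used on the closed unit disk. -/
def dilog (z : ℂ) : ℂ := ∑' n : ℕ, z ^ (n + 1) / ((n : ℂ) + 1) ^ 2

/-- The principal square root: the imaginary part of the logarithm lies in `(-π, π]`. Its real
part is nonnegative. -/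
def psqrt (w : ℂ) : ℂ := w ^ (1 / 2 : ℂ)

/-- The root dilogarithm `f_k(z) = (1/k) Re √Li₂(z^k)`. -/
def rootDilog (k : ℕ) (z : ℂ) : ℝ := 1 / (k : ℝ) * (psqrt (dilog (z ^ k))).re

/-! ### Phase functions of a general exponent sequence -/

/-- `e_k(x) = exp(2 π i x / k)`. -/
def expk (k : ℕ) (x : ℤ) : ℂ := Complex.exp (2 * Real.pi * Complex.I * x / k)

/-- The Dirichlet series `D_{t,k}(s) = ∑_{m ≥ 1} a_m e_k(m t) / m^s`, for `Re s > 1`. -/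
def dirichletD (a : ℕ → ℕ) (t k : ℕ) (s : ℂ) : ℂ :=
  LSeries (fun m : ℕ => (a m : ℂ) * expk k (m * t)) s

/-- The residue of `D_{t,k}` at `s = 1`. As `D_{t,k}` has at most a simple pole there, this is
the limit of `(s - 1) D_{t,k}(s)`, taken inside the half-plane of convergence `Re s > 1`. -/
def resD (a : ℕ → ℕ) (t k : ℕ) : ℂ :=
  limUnder (𝓝[{s : ℂ | 1 < s.re}] 1) (fun s : ℂ => (s - 1) * dirichletD a t k s)

/-- `c_k(j) = (1/k) ∑_{t=1}^k e_k(-t j) Res(D_{t,k}, s = 1)`. -/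
def coeffC (a : ℕ → ℕ) (k j : ℕ) : ℂ :=
  1 / (k : ℂ) * ∑ t ∈ Finset.Icc 1 k, expk k (-((t : ℤ) * j)) * resD a t k

/-- `L_{h,k}(z)`, the principal square root of `∑_{j=1}^k c_k(j) Li₂(e_k(j h) z)`. -/
def phaseFunction (a : ℕ → ℕ) (h k : ℕ) (z : ℂ) : ℂ :=
  psqrt (∑ j ∈ Finset.Icc 1 k, coeffC a k j * dilog (expk k (j * h) * z))

/-! ### Phases of a sequence of functions -/

/-- The sets `R m` form a decomposition of `U` into finitely many disjoint nonempty open sets,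
together with their boundaries, with `Re L_m` strictly larger than every other `Re L_k` on `R m`.
An index `m` with `R m = ∅` is an index that does not occur in the decomposition. -/
structure IsPhaseDecomposition {ι : Type*} (U : Set ℂ) (L : ι → ℂ → ℂ) (R : ι → Set ℂ) :
    Prop where
  isOpen : ∀ m, IsOpen (R m)
  subset : ∀ m, R m ⊆ U
  disjoint : ∀ m k, m ≠ k → Disjoint (R m) (R k)
  finite : {m | (R m).Nonempty}.Finite
  cover : U ⊆ ⋃ m, closure (R m)
  dominant : ∀ m, ∀ z ∈ R m, ∀ k, k ≠ m → (L k z).re < (L m z).re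

/-- `R` is the family of phases of `L` on `U`: a decomposition as above that is maximal for
inclusion of each of its sets. The phases are its nonempty members. -/
def IsPhaseFamily {ι : Type*} (U : Set ℂ) (L : ι → ℂ → ℂ) (R : ι → Set ℂ) : Prop :=
  Maximal (IsPhaseDecomposition U L) R

/-! ### Partitions into odd parts -/

/-- The exponent sequence of the odd-part partition polynomials, the indicator of the odd
positive integers. -/
def oddExponent (m : ℕ) : ℕ := if Odd m then 1 else 0

/-- The phase functions in closed form (without the common factor `1/√2`):
`L_k(z) = (1/k) √Li₂(z^k)` for odd `k`, and `L_{2j}(z) = (1/j) √Li₂(-z^j)`. -/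
def oddL (k : ℕ) (z : ℂ) : ℂ :=
  if Odd k then 1 / (k : ℂ) * psqrt (dilog (z ^ k))
  else 1 / ((k / 2 : ℕ) : ℂ) * psqrt (dilog (-z ^ (k / 2)))

/-- The open unit disk. -/
def unitDisk : Set ℂ := Metric.ball 0 1

/-- `γ`: the part of the level set `Re L₁ = Re L₄` in the closed first quadrant of the open unit
disk, the origin (where all phase functions vanish) being left out. -/
def gammaCurve : Set ℂ :=
  {z | z ∈ unitDisk ∧ z ≠ 0 ∧ 0 ≤ z.re ∧ 0 ≤ z.im ∧ (oddL 1 z).re = (oddL 4 z).re}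

/-- The segment `i [-β, β]`. -/
def imagSegment (β : ℝ) : Set ℂ := (fun t : ℝ => Complex.I * (t : ℂ)) '' Icc (-β) β

end

end OddPartitionPhases

namespace OddPartitionPhases
open MeasureTheory

/-! ### The law of a product of two uniform variables, and the dilogarithm as a Stieltjes transform -/

/-! Closed form: the residue of the Dirichlet series of a periodic sequence is its mean, so
orthogonality of the additive characters makes the weight of `z ^ n` in `L_{h,k}` nonzero only when
`k ∣ 2 n`. The surviving powers sum to `Li₂(± z ^ d) / (2 d²)` with `d = k` or `d = k / 2`, and `√2`
absorbs the remaining factor.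

Phases: everything rests on `(Re √w)² = (|w| + Re w) / 2` and on `Li₂(z) = ∫ z / (1 - t z) dμ(t)`,
where `μ` is the law of a product of two uniform variables. Pointwise estimates of the kernel give
three facts. For `Re z > 0`, `Re L₂ < Re L₁` (`psqrt_dilog_neg_re_lt`). For `Re z ≥ 0`, `(Re L₁)² ≥
3/10 |z|` (`psqrt_dilog_re_sq_ge`), which beats the bound `5/27 |z|` valid for every index other
than 1, 2, 4 (`reL_sq_le`). On the imaginary axis, `(f₁(ir)² - f₂(r)²) / r` decreases strictly from
positive to negative, which produces `β` (`axisDiff_strictAntiOn`). The map `z ↦ -z` swaps `L₁` with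
`L₂` and fixes `Re L₄`, so the right half disk suffices.

Hence the regions of strict dominance are decided by the signs of `Re z` and of `Re L₁ - Re L₄`. No
parametrization of `γ` is needed: inside the quarter disk `L₁ - L₄` is holomorphic and not constant,
so by the open mapping theorem its real part takes both signs near each of its zeros
(`frequently_of_re_pos`), and every level point borders both regions. Every decomposition is
contained in these regions, and they form a decomposition themselves, whence uniqueness of the
maximal family. -/

/-- The law of the product of two independent uniform variables on `(0, 1)`. Its `n`-th moment is
`1 / (n + 1)²`. -/
noncomputable def productLaw : Measure ℝ :=
  ((volume.restrict (Ioo (0 : ℝ) 1)).prod (volume.restrict (Ioo (0 : ℝ) 1))).map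
    (fun p : ℝ × ℝ => p.1 * p.2)

instance isProbabilityMeasure_uniform :
    IsProbabilityMeasure (volume.restrict (Ioo (0 : ℝ) 1)) :=
  ⟨by simp⟩

instance isProbabilityMeasure_productLaw : IsProbabilityMeasure productLaw :=
  Measure.isProbabilityMeasure_map (by fun_prop)

theorem ae_productLaw_mem : ∀ᵐ t ∂productLaw, t ∈ Ioo (0 : ℝ) 1 := by
  refine (ae_map_iff (by fun_prop) (measurableSet_Ioo (a := (0 : ℝ)) (b := 1))).2 ?_
  rw [Measure.prod_restrict]
  filter_upwards [ae_restrict_mem (measurableSet_Ioo.prod measurableSet_Ioo)] with p hp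
  obtain ⟨⟨h1, h2⟩, h3, h4⟩ := hp
  exact ⟨mul_pos h1 h3, by nlinarith⟩

theorem integral_pow_productLaw (n : ℕ) : ∫ t, t ^ n ∂productLaw = 1 / ((n : ℝ) + 1) ^ 2 := by
  rw [productLaw, integral_map (by fun_prop) (by fun_prop)]
  simp_rw [mul_pow]
  rw [integral_prod_mul (fun x : ℝ => x ^ n) (fun x : ℝ => x ^ n), ← integral_Ioc_eq_integral_Ioo,
    ← intervalIntegral.integral_of_le zero_le_one, integral_pow]
  simp
  rw [← inv_pow, sq]

theorem summable_one_div_succ_sq : Summable fun n : ℕ => 1 / ((n : ℝ) + 1) ^ 2 := by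
  have := (summable_nat_add_iff 1).2 (Real.summable_one_div_nat_pow.2 one_lt_two)
  simpa using this

theorem integrable_of_bounded {E : Type*} [NormedAddCommGroup E] {f : ℝ → E} (C : ℝ)
    (hf : AEStronglyMeasurable f productLaw) (h : ∀ t ∈ Ioo (0 : ℝ) 1, ‖f t‖ ≤ C) :
    Integrable f productLaw :=
  Integrable.of_bound hf C (ae_productLaw_mem.mono h)

theorem integral_pos_productLaw {f : ℝ → ℝ} (hf : Integrable f productLaw)
    (h : ∀ t ∈ Ioo (0 : ℝ) 1, 0 < f t) : 0 < ∫ t, f t ∂productLaw := by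
  have h0 : 0 ≤ᵐ[productLaw] f := ae_productLaw_mem.mono fun t ht => (h t ht).le
  refine lt_of_le_of_ne (integral_nonneg_of_ae h0) fun h1 => ?_
  have h2 := (integral_eq_zero_iff_of_nonneg_ae h0 hf).1 h1.symm
  obtain ⟨t, ht, ht'⟩ := (ae_productLaw_mem.and h2).exists
  exact (h t ht).ne' ht'

theorem integral_mono_productLaw {f g : ℝ → ℝ} (hf : Integrable f productLaw)
    (hg : Integrable g productLaw) (h : ∀ t ∈ Ioo (0 : ℝ) 1, f t ≤ g t) :
    ∫ t, f t ∂productLaw ≤ ∫ t, g t ∂productLaw :=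
  integral_mono_ae hf hg (ae_productLaw_mem.mono h)

theorem integrable_pow_productLaw (n : ℕ) : Integrable (fun t : ℝ => t ^ n) productLaw :=
  integrable_of_bounded 1 (by fun_prop) fun t ht => by
    rw [norm_pow, Real.norm_of_nonneg ht.1.le]
    exact pow_le_one₀ ht.1.le ht.2.le

/-- The Cauchy kernel `1 / (1 - t z)`. -/
noncomputable def cauchyKernel (z : ℂ) (t : ℝ) : ℂ := (1 - (t : ℂ) * z)⁻¹

/-- The Stieltjes transform `∫ 1 / (1 - t z)` of the product law. -/
noncomputable def stieltjes (z : ℂ) : ℂ := ∫ t, cauchyKernel z t ∂productLaw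

theorem measurable_cauchyKernel (z : ℂ) : Measurable (cauchyKernel z) := by
  unfold cauchyKernel; fun_prop

theorem dilog_eq_mul_stieltjes {z : ℂ} (hz : ‖z‖ ≤ 1) : dilog z = z * stieltjes z := by
  have hnorm : ∀ (n : ℕ), ∀ t ∈ Ioo (0 : ℝ) 1, ‖((t : ℂ) * z) ^ n‖ ≤ t ^ n := fun n t ht => by
    rw [norm_pow, norm_mul, Complex.norm_real, Real.norm_of_nonneg ht.1.le]
    exact pow_le_pow_left₀ (by have := ht.1; positivity)
      (mul_le_of_le_one_right ht.1.le hz) n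
  have hint : ∀ n : ℕ, Integrable (fun t : ℝ => ((t : ℂ) * z) ^ n) productLaw := fun n =>
    integrable_of_bounded 1 (by fun_prop) fun t ht =>
      (hnorm n t ht).trans (pow_le_one₀ ht.1.le ht.2.le)
  have hs : Summable fun n : ℕ => ∫ t : ℝ, ‖((t : ℂ) * z) ^ n‖ ∂productLaw := by
    refine Summable.of_nonneg_of_le (fun n => integral_nonneg fun t => norm_nonneg _)
      (fun n => ?_) summable_one_div_succ_sq
    rw [← integral_pow_productLaw]
    exact integral_mono_productLaw (hint n).norm (integrable_pow_productLaw n) (hnorm n)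
  have key := hasSum_integral_of_summable_integral_norm hint hs
  have h1 : ∀ n : ℕ, ∫ t : ℝ, ((t : ℂ) * z) ^ n ∂productLaw = z ^ n / ((n : ℂ) + 1) ^ 2 := by
    intro n
    simp_rw [mul_pow]
    rw [integral_mul_const]
    have := integral_pow_productLaw n
    have h2 : ∫ t : ℝ, (t : ℂ) ^ n ∂productLaw = ((1 / ((n : ℝ) + 1) ^ 2 : ℝ) : ℂ) := by
      rw [← this, ← integral_complex_ofReal]
      simp
    rw [h2]; push_cast; ring
  have h2 : ∫ t : ℝ, ∑' n : ℕ, ((t : ℂ) * z) ^ n ∂productLaw = stieltjes z := by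
    refine integral_congr_ae (ae_productLaw_mem.mono fun t ht => ?_)
    refine tsum_geometric_of_norm_lt_one ?_
    rw [norm_mul, Complex.norm_real, Real.norm_of_nonneg ht.1.le]
    exact (mul_le_of_le_one_right ht.1.le hz).trans_lt ht.2
  rw [h2] at key
  simp_rw [h1] at key
  rw [← key.tsum_eq, dilog, ← tsum_mul_left]
  congr 1; ext n; ring

/-! ### Elementary properties of the dilogarithm -/

theorem norm_dilog_term_le {z : ℂ} (hz : ‖z‖ ≤ 1) (n : ℕ) :
    ‖z ^ (n + 1) / ((n : ℂ) + 1) ^ 2‖ ≤ ‖z‖ * (1 / ((n : ℝ) + 1) ^ 2) := by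
  have h : ‖(n : ℂ) + 1‖ = (n : ℝ) + 1 := by
    have := Complex.norm_natCast (n + 1)
    push_cast at this
    exact this
  rw [norm_div, norm_pow, norm_pow, h, pow_succ, ← mul_one_div]
  gcongr
  exact mul_le_of_le_one_left (norm_nonneg z) (pow_le_one₀ (norm_nonneg _) hz)

theorem norm_dilog_term_le_one {z : ℂ} (hz : ‖z‖ ≤ 1) (n : ℕ) :
    ‖z ^ (n + 1) / ((n : ℂ) + 1) ^ 2‖ ≤ 1 / ((n : ℝ) + 1) ^ 2 :=
  (norm_dilog_term_le hz n).trans (mul_le_of_le_one_left (by positivity) hz)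

theorem summable_dilog {z : ℂ} (hz : ‖z‖ ≤ 1) :
    Summable fun n : ℕ => z ^ (n + 1) / ((n : ℂ) + 1) ^ 2 :=
  Summable.of_norm_bounded summable_one_div_succ_sq (norm_dilog_term_le_one hz)

theorem tsum_one_div_succ_sq : ∑' n : ℕ, 1 / ((n : ℝ) + 1) ^ 2 = Real.pi ^ 2 / 6 := by
  have h := (hasSum_nat_add_iff' 1).2 hasSum_zeta_two
  simpa using h.tsum_eq

theorem norm_dilog_le {z : ℂ} (hz : ‖z‖ ≤ 1) : ‖dilog z‖ ≤ 5 / 3 * ‖z‖ := by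
  have h1 : ‖dilog z‖ ≤ ∑' n : ℕ, ‖z‖ * (1 / ((n : ℝ) + 1) ^ 2) :=
    tsum_of_norm_bounded (summable_one_div_succ_sq.mul_left ‖z‖).hasSum (norm_dilog_term_le hz)
  rw [tsum_mul_left, tsum_one_div_succ_sq] at h1
  -- The constant `5/3` is a rational upper bound for `ζ(2) ≈ 1.645`.
  have : Real.pi ^ 2 / 6 ≤ 5 / 3 := by nlinarith [Real.pi_lt_d2, Real.pi_pos]
  nlinarith [norm_nonneg z]

@[simp] theorem dilog_zero : dilog 0 = 0 := by simp [dilog]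

theorem dilog_conj (z : ℂ) : dilog (conj z) = conj (dilog z) := by
  rw [dilog, dilog, Complex.conj_tsum]
  congr 1; ext n; simp

theorem continuousOn_dilog : ContinuousOn dilog (Metric.closedBall 0 1) :=
  continuousOn_tsum (fun n => by fun_prop) summable_one_div_succ_sq fun n z hz =>
    norm_dilog_term_le_one (by simpa using hz) n

theorem differentiableOn_dilog : DifferentiableOn ℂ dilog (Metric.ball 0 1) :=
  Complex.differentiableOn_tsum_of_summable_norm summable_one_div_succ_sq (fun n => by fun_prop)
    Metric.isOpen_ball fun n z hz => norm_dilog_term_le_one (mem_ball_zero_iff.1 hz).le n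

theorem dilog_ofReal (r : ℝ) :
    dilog r = ((∑' n : ℕ, r ^ (n + 1) / ((n : ℝ) + 1) ^ 2 : ℝ) : ℂ) := by
  rw [dilog, Complex.ofReal_tsum]
  congr 1; ext n; push_cast; rfl

/-! ### The real part of the principal square root -/

theorem psqrt_sq (w : ℂ) : psqrt w ^ 2 = w := by
  rw [psqrt]
  simp

theorem psqrt_re_nonneg (w : ℂ) : 0 ≤ (psqrt w).re := by
  rcases eq_or_ne w 0 with rfl | hw
  · simp [psqrt]
  · rw [psqrt, Complex.cpow_def_of_ne_zero hw, Complex.exp_re]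
    refine mul_nonneg (Real.exp_pos _).le (Real.cos_nonneg_of_mem_Icc ?_)
    have h1 := Complex.neg_pi_lt_arg w
    have h2 := Complex.arg_le_pi w
    have h3 : (Complex.log w * (1 / 2)).im = w.arg / 2 := by
      have : (1 / 2 : ℂ) = ((1 / 2 : ℝ) : ℂ) := by norm_num
      rw [this, Complex.im_mul_ofReal, Complex.log_im]; ring
    rw [h3]
    constructor <;> linarith

theorem psqrt_re_sq (w : ℂ) : (psqrt w).re ^ 2 = (‖w‖ + w.re) / 2 := by
  have h1 : ‖psqrt w‖ ^ 2 = ‖w‖ := by rw [← norm_pow, psqrt_sq]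
  have h2 : (psqrt w ^ 2).re = w.re := by rw [psqrt_sq]
  rw [← Complex.normSq_eq_norm_sq, Complex.normSq_apply] at h1
  rw [sq, Complex.mul_re] at h2
  linarith

theorem psqrt_re (w : ℂ) : (psqrt w).re = √((‖w‖ + w.re) / 2) := by
  rw [← psqrt_re_sq, Real.sqrt_sq (psqrt_re_nonneg w)]

theorem psqrt_ofReal_mul {r : ℝ} (hr : 0 ≤ r) (w : ℂ) :
    psqrt (r * w) = (√r : ℝ) * psqrt w := by
  rcases eq_or_ne w 0 with rfl | hw
  · simp [psqrt]
  rcases hr.eq_or_lt with rfl | hr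
  · simp [psqrt]
  have hr' : (r : ℂ) ≠ 0 := by exact_mod_cast hr.ne'
  rw [Real.sqrt_eq_rpow, Complex.ofReal_cpow hr.le, psqrt, psqrt,
    Complex.cpow_def_of_ne_zero (mul_ne_zero hr' hw), Complex.cpow_def_of_ne_zero hr',
    Complex.cpow_def_of_ne_zero hw, Complex.log_ofReal_mul hr hw, ← Complex.exp_add,
    Complex.ofReal_log hr.le]
  push_cast
  ring_nf

theorem continuous_psqrt_re : Continuous fun w => (psqrt w).re := by
  simp_rw [psqrt_re]
  fun_prop

/-! ### The kernel of the dilogarithm -/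

/-- The kernel `z / (1 - t z)` of the integral representation of the dilogarithm. -/
noncomputable def dilogKernel (z : ℂ) (t : ℝ) : ℂ := z * cauchyKernel z t

theorem dilog_eq_integral {z : ℂ} (hz : ‖z‖ ≤ 1) :
    dilog z = ∫ t, dilogKernel z t ∂productLaw := by
  rw [dilog_eq_mul_stieltjes hz, stieltjes, ← integral_const_mul]
  rfl

/-- `|1 - t z|²` in real coordinates. -/
theorem normSq_one_sub (z : ℂ) (t : ℝ) :
    Complex.normSq (1 - (t : ℂ) * z) = 1 - 2 * t * z.re + t ^ 2 * (z.re ^ 2 + z.im ^ 2) := by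
  simp [Complex.normSq_apply]; ring

theorem norm_sq_eq (z : ℂ) : ‖z‖ ^ 2 = z.re ^ 2 + z.im ^ 2 := by
  rw [← Complex.normSq_eq_norm_sq, Complex.normSq_apply]; ring

theorem cauchyKernel_re (z : ℂ) (t : ℝ) : (cauchyKernel z t).re =
    (1 - t * z.re) / (1 - 2 * t * z.re + t ^ 2 * (z.re ^ 2 + z.im ^ 2)) := by
  rw [cauchyKernel, Complex.inv_re, normSq_one_sub]; simp

theorem cauchyKernel_im (z : ℂ) (t : ℝ) : (cauchyKernel z t).im =
    t * z.im / (1 - 2 * t * z.re + t ^ 2 * (z.re ^ 2 + z.im ^ 2)) := by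
  rw [cauchyKernel, Complex.inv_im, normSq_one_sub]; simp

theorem normSq_pos {z : ℂ} (hz : ‖z‖ ≤ 1) {t : ℝ} (ht : t ∈ Ioo (0 : ℝ) 1) :
    0 < 1 - 2 * t * z.re + t ^ 2 * (z.re ^ 2 + z.im ^ 2) := by
  rw [← normSq_one_sub]
  refine Complex.normSq_pos.2 fun h => ?_
  have h1 : ‖(t : ℂ) * z‖ = 1 := by rw [← sub_eq_zero.1 h]; simp
  rw [norm_mul, Complex.norm_real, Real.norm_of_nonneg ht.1.le] at h1
  nlinarith [ht.1, ht.2, norm_nonneg z]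

theorem dilogKernel_re (z : ℂ) (t : ℝ) : (dilogKernel z t).re =
    (z.re - t * (z.re ^ 2 + z.im ^ 2)) /
      (1 - 2 * t * z.re + t ^ 2 * (z.re ^ 2 + z.im ^ 2)) := by
  rw [dilogKernel, Complex.mul_re, cauchyKernel_re, cauchyKernel_im]; ring

theorem dilogKernel_im (z : ℂ) (t : ℝ) : (dilogKernel z t).im =
    z.im / (1 - 2 * t * z.re + t ^ 2 * (z.re ^ 2 + z.im ^ 2)) := by
  rw [dilogKernel, Complex.mul_im, cauchyKernel_re, cauchyKernel_im]; ring

theorem integrable_cauchyKernel {z : ℂ} (hz : ‖z‖ < 1) :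
    Integrable (cauchyKernel z) productLaw := by
  refine integrable_of_bounded (1 - ‖z‖)⁻¹ (measurable_cauchyKernel z).aestronglyMeasurable
    fun t ht => ?_
  rw [cauchyKernel, norm_inv]
  refine inv_anti₀ (by linarith) ?_
  have h1 := norm_sub_norm_le (1 : ℂ) (t * z)
  rw [norm_one, norm_mul, Complex.norm_real, Real.norm_of_nonneg ht.1.le] at h1
  nlinarith [ht.2, norm_nonneg z]

theorem integrable_cauchyKernel_of_re_nonpos {z : ℂ} (hz : z.re ≤ 0) :
    Integrable (cauchyKernel z) productLaw := by
  refine integrable_of_bounded 1 (measurable_cauchyKernel z).aestronglyMeasurable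
    fun t ht => ?_
  rw [cauchyKernel, norm_inv]
  refine inv_le_one_of_one_le₀ ?_
  have h1 := Complex.re_le_norm (1 - (t : ℂ) * z)
  have h2 : (1 - (t : ℂ) * z).re = 1 - t * z.re := by simp
  nlinarith [ht.1]

theorem integrable_dilogKernel {z : ℂ} (hz : ‖z‖ < 1) :
    Integrable (dilogKernel z) productLaw :=
  (integrable_cauchyKernel hz).const_mul z

theorem re_integral {f : ℝ → ℂ} (hf : Integrable f productLaw) :
    (∫ t, f t ∂productLaw).re = ∫ t, (f t).re ∂productLaw :=
  (Complex.reCLM.integral_comp_comm hf).symm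

theorem im_integral {f : ℝ → ℂ} (hf : Integrable f productLaw) :
    (∫ t, f t ∂productLaw).im = ∫ t, (f t).im ∂productLaw :=
  (Complex.imCLM.integral_comp_comm hf).symm

theorem dilog_im_pos {z : ℂ} (hz : ‖z‖ < 1) (h : 0 < z.im) : 0 < (dilog z).im := by
  rw [dilog_eq_integral hz.le, im_integral (integrable_dilogKernel hz)]
  refine integral_pos_productLaw (integrable_dilogKernel hz).im fun t ht => ?_
  rw [dilogKernel_im]
  exact div_pos h (normSq_pos hz.le ht)

theorem dilog_im_neg {z : ℂ} (hz : ‖z‖ < 1) (h : z.im < 0) : (dilog z).im < 0 := by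
  have := dilog_im_pos (z := conj z) (by simpa using hz) (by simpa using h)
  rw [dilog_conj] at this
  simpa using this

/-! ### Comparison of `Re √Li₂(z)` and `Re √Li₂(-z)` -/

theorem dilog_neg_re_lt {z : ℂ} (hz : ‖z‖ < 1) (h : 0 < z.re) :
    (dilog (-z)).re < (dilog z).re := by
  have hz' : ‖-z‖ < 1 := by simpa using hz
  have i1 : Integrable (fun t => (dilogKernel z t).re) productLaw :=
    (integrable_dilogKernel hz).re
  have i2 : Integrable (fun t => (dilogKernel (-z) t).re) productLaw :=
    (integrable_dilogKernel hz').re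
  rw [dilog_eq_integral hz.le, re_integral (integrable_dilogKernel hz),
    dilog_eq_integral hz'.le, re_integral (integrable_dilogKernel hz'), ← sub_pos,
    ← integral_sub i1 i2]
  refine integral_pos_productLaw (i1.sub i2) fun t ht => ?_
  change 0 < (dilogKernel z t).re - (dilogKernel (-z) t).re
  have p1 := normSq_pos hz.le ht
  have p2 := normSq_pos hz'.le ht
  rw [sub_pos, dilogKernel_re, dilogKernel_re, div_lt_div_iff₀ p2 p1]
  have hr : z.re ^ 2 + z.im ^ 2 < 1 := by
    rw [← norm_sq_eq]; nlinarith [norm_nonneg z]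
  have h3 : t ^ 2 * (z.re ^ 2 + z.im ^ 2) < 1 := by nlinarith [ht.1, ht.2]
  simp only [Complex.neg_re, Complex.neg_im]
  -- After cross-multiplication the difference of the two sides is `2 Re z (1 - t² |z|²)`.
  nlinarith [mul_pos h (sub_pos.2 h3)]

/-- This is the integrand of `|Li₂|²` written as a double integral. After clearing denominators the
difference is the explicitly nonnegative product `hfin`. -/
theorem dilogKernel_mul_conj_re_le {z : ℂ} (hz : ‖z‖ < 1) (h : 0 < z.re) {t s : ℝ}
    (ht : t ∈ Ioo (0 : ℝ) 1) (hs : s ∈ Ioo (0 : ℝ) 1) :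
    (dilogKernel (-z) t * conj (dilogKernel (-z) s)).re ≤
      (dilogKernel z t * conj (dilogKernel z s)).re := by
  have hz' : ‖-z‖ < 1 := by simpa using hz
  have key : ∀ w : ℂ, (dilogKernel w t * conj (dilogKernel w s)).re =
      (w.re ^ 2 + w.im ^ 2) * (1 - (t + s) * w.re + t * s * (w.re ^ 2 + w.im ^ 2)) /
      ((1 - 2 * t * w.re + t ^ 2 * (w.re ^ 2 + w.im ^ 2)) *
       (1 - 2 * s * w.re + s ^ 2 * (w.re ^ 2 + w.im ^ 2))) := by
    intro w
    rw [Complex.mul_re, Complex.conj_re, Complex.conj_im, dilogKernel_re, dilogKernel_re,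
      dilogKernel_im, dilogKernel_im, mul_neg, sub_neg_eq_add, div_mul_div_comm,
      div_mul_div_comm, ← add_div]
    congr 1
    ring
  have p1 := normSq_pos hz.le ht
  have p2 := normSq_pos hz'.le ht
  have p3 := normSq_pos hz.le hs
  have p4 := normSq_pos hz'.le hs
  rw [key, key, div_le_div_iff₀ (mul_pos p2 p4) (mul_pos p1 p3)]
  simp only [Complex.neg_re, Complex.neg_im]
  have hr : z.re ^ 2 + z.im ^ 2 < 1 := by
    rw [← norm_sq_eq]; nlinarith [norm_nonneg z]
  have ht2 : 0 < 1 - t ^ 2 * (z.re ^ 2 + z.im ^ 2) := by nlinarith [ht.1, ht.2]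
  have hs2 : 0 < 1 - s ^ 2 * (z.re ^ 2 + z.im ^ 2) := by nlinarith [hs.1, hs.2]
  have h1 := ht.1
  have h2 := hs.1
  have hfin : 0 ≤ (z.re ^ 2 + z.im ^ 2) * (2 * (t + s) * z.re *
      ((1 - t ^ 2 * (z.re ^ 2 + z.im ^ 2)) * (1 - s ^ 2 * (z.re ^ 2 + z.im ^ 2))
        + 4 * t * s * z.im ^ 2)) := by positivity
  linear_combination hfin

/-- Comparing the moduli of the kernels would not compare the moduli of their integrals. Instead `|∫
K|² = ∬ Re (K t * conj (K s))` is compared pointwise in `(t, s)`. -/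
theorem norm_dilog_neg_le {z : ℂ} (hz : ‖z‖ < 1) (h : 0 < z.re) :
    ‖dilog (-z)‖ ≤ ‖dilog z‖ := by
  have hz' : ‖-z‖ < 1 := by simpa using hz
  have i1 := integrable_dilogKernel hz
  have i2 := integrable_dilogKernel hz'
  have key : ∀ w : ℂ, ‖w‖ < 1 →
      ‖dilog w‖ ^ 2 = ∫ t, (dilogKernel w t * conj (dilog w)).re ∂productLaw := by
    intro w hw
    rw [← re_integral ((integrable_dilogKernel hw).mul_const _), integral_mul_const,
      ← dilog_eq_integral hw.le, Complex.mul_conj, Complex.ofReal_re, Complex.normSq_eq_norm_sq]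
  have conj_int : ∀ w : ℂ, ‖w‖ < 1 →
      Integrable (fun s => conj (dilogKernel w s)) productLaw := fun w hw =>
    (Complex.conjCLE : ℂ →L[ℝ] ℂ).integrable_comp (integrable_dilogKernel hw)
  have key2 : ∀ w : ℂ, ‖w‖ < 1 → ∀ t, (dilogKernel w t * conj (dilog w)).re =
      ∫ s, (dilogKernel w t * conj (dilogKernel w s)).re ∂productLaw := by
    intro w hw t
    rw [← re_integral ((conj_int w hw).const_mul _), integral_const_mul, integral_conj,
      ← dilog_eq_integral hw.le]
  refine le_of_sq_le_sq ?_ (norm_nonneg _)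
  rw [key z hz, key _ hz']
  refine integral_mono_productLaw (i2.mul_const _).re (i1.mul_const _).re fun t ht => ?_
  rw [key2 z hz, key2 _ hz']
  exact integral_mono_productLaw ((conj_int _ hz').const_mul _).re
    ((conj_int _ hz).const_mul _).re fun s hs => dilogKernel_mul_conj_re_le hz h ht hs

theorem psqrt_dilog_neg_re_lt {z : ℂ} (hz : ‖z‖ < 1) (h : 0 < z.re) :
    (psqrt (dilog (-z))).re < (psqrt (dilog z)).re := by
  refine lt_of_pow_lt_pow_left₀ 2 (psqrt_re_nonneg _) ?_
  rw [psqrt_re_sq, psqrt_re_sq]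
  linarith [dilog_neg_re_lt hz h, norm_dilog_neg_le hz h]

/-! ### A lower bound in the right half disk -/

/-- The real part of the Cauchy kernel is at least `1 - t²` on the right half disk, and the mean of
`1 - t²` is `1 - 1/9`. -/
theorem stieltjes_re_ge {z : ℂ} (hz : ‖z‖ < 1) (h : 0 ≤ z.re) : 8 / 9 ≤ (stieltjes z).re := by
  have i1 := integrable_cauchyKernel hz
  have i2 : Integrable (fun t : ℝ => 1 - t ^ 2) productLaw :=
    (integrable_const 1).sub (integrable_pow_productLaw 2)
  rw [stieltjes, re_integral i1]
  have h1 : ∫ t : ℝ, (1 - t ^ 2) ∂productLaw = 8 / 9 := by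
    rw [integral_sub (integrable_const 1) (integrable_pow_productLaw 2), integral_pow_productLaw]
    simp; norm_num
  rw [← h1]
  refine integral_mono_productLaw i2 i1.re fun t ht => ?_
  rw [cauchyKernel_re, le_div_iff₀ (normSq_pos hz.le ht)]
  have hr : z.re ^ 2 + z.im ^ 2 < 1 := by
    rw [← norm_sq_eq]; nlinarith [norm_nonneg z]
  obtain ⟨h1, h2⟩ := ht
  have h3 : 0 ≤ t * z.re := mul_nonneg h1.le h
  have h4 : 0 ≤ 1 - t ^ 2 := by nlinarith
  have h5 : 0 ≤ t ^ 2 * (1 - (z.re ^ 2 + z.im ^ 2)) := by nlinarith [sq_nonneg t]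
  have h6 : t * z.re * t ^ 2 ≤ t * z.re := by nlinarith
  nlinarith [mul_nonneg h4 h3, mul_nonneg h4 h5, sq_nonneg (t^2)]

/-- The real part of the kernel is at least `-|z|² t`, and `t` has mean `1/4`. -/
theorem dilog_re_ge {z : ℂ} (hz : ‖z‖ < 1) (h : 0 ≤ z.re) : -‖z‖ / 4 ≤ (dilog z).re := by
  have i1 := integrable_dilogKernel hz
  have i2 : Integrable (fun t : ℝ => -‖z‖ ^ 2 * t ^ 1) productLaw :=
    (integrable_pow_productLaw 1).const_mul _
  have h1 : ∫ t : ℝ, -‖z‖ ^ 2 * t ^ 1 ∂productLaw = -‖z‖ ^ 2 / 4 := by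
    rw [integral_const_mul, integral_pow_productLaw]; norm_num; ring
  have h2 : -‖z‖ ^ 2 / 4 ≤ (dilog z).re := by
    rw [← h1, dilog_eq_integral hz.le, re_integral i1]
    refine integral_mono_productLaw i2 i1.re fun t ht => ?_
    rw [dilogKernel_re, le_div_iff₀ (normSq_pos hz.le ht), norm_sq_eq]
    have hr : z.re ^ 2 + z.im ^ 2 < 1 := by
      rw [← norm_sq_eq]; nlinarith [norm_nonneg z]
    obtain ⟨h1, h2⟩ := ht
    set R := z.re ^ 2 + z.im ^ 2 with hR
    have hR0 : 0 ≤ R := by positivity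
    have h3 : t ^ 2 * R ≤ 1 := by nlinarith
    have hN := normSq_pos hz.le ⟨h1, h2⟩
    rw [← hR] at hN
    have h4 : 0 ≤ z.re * (1 - t ^ 2 * R) + t ^ 3 * R ^ 2 *
        (1 - 2 * t * z.re + t ^ 2 * R) := by
      have := sub_nonneg.2 h3
      positivity
    have h5 : 0 < 1 + t ^ 2 * R := by positivity
    -- Multiplying by `1 + t² R` turns the difference of the two sides into the nonnegative sum
    -- `h4`.
    refine le_of_mul_le_mul_right ?_ h5
    linear_combination h4
  nlinarith [norm_nonneg z]

/-- The two bounds give `(8/9 - 1/4) / 2 = 23/72 > 3/10`. -/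
theorem psqrt_dilog_re_sq_ge {z : ℂ} (hz : ‖z‖ < 1) (h : 0 ≤ z.re) :
    3 / 10 * ‖z‖ ≤ (psqrt (dilog z)).re ^ 2 := by
  rw [psqrt_re_sq]
  have h1 := dilog_re_ge hz h
  have h2 : 8 / 9 * ‖z‖ ≤ ‖dilog z‖ := by
    rw [dilog_eq_mul_stieltjes hz.le, norm_mul]
    nlinarith [norm_nonneg z, Complex.re_le_norm (stieltjes z), stieltjes_re_ge hz h]
  linarith [norm_nonneg z]

theorem psqrt_dilog_re_sq_le {z : ℂ} (hz : ‖z‖ ≤ 1) :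
    (psqrt (dilog z)).re ^ 2 ≤ 5 / 3 * ‖z‖ := by
  rw [psqrt_re_sq]
  linarith [norm_dilog_le hz, Complex.re_le_norm (dilog z)]

/-! ### The phase functions on the imaginary axis -/

theorem cauchyKernel_imag_re (r t : ℝ) :
    (cauchyKernel (Complex.I * r) t).re = 1 / (1 + t ^ 2 * r ^ 2) := by
  rw [cauchyKernel_re]; simp

theorem cauchyKernel_imag_im (r t : ℝ) :
    (cauchyKernel (Complex.I * r) t).im = t * r / (1 + t ^ 2 * r ^ 2) := by
  rw [cauchyKernel_im]; simp

theorem integrable_cauchyKernel_imag (r : ℝ) :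
    Integrable (cauchyKernel (Complex.I * r)) productLaw :=
  integrable_cauchyKernel_of_re_nonpos (by simp)

theorem integrable_cauchyKernel_imag_re (r : ℝ) :
    Integrable (fun t : ℝ => 1 / (1 + t ^ 2 * r ^ 2)) productLaw := by
  simp_rw [← cauchyKernel_imag_re]
  exact (integrable_cauchyKernel_imag r).re

theorem integrable_cauchyKernel_imag_im (r : ℝ) :
    Integrable (fun t : ℝ => t * r / (1 + t ^ 2 * r ^ 2)) productLaw := by
  simp_rw [← cauchyKernel_imag_im]
  exact (integrable_cauchyKernel_imag r).im

theorem stieltjes_imag_re (r : ℝ) :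
    (stieltjes (Complex.I * r)).re = ∫ t : ℝ, 1 / (1 + t ^ 2 * r ^ 2) ∂productLaw := by
  rw [stieltjes, re_integral (integrable_cauchyKernel_imag r)]
  simp_rw [cauchyKernel_imag_re]

theorem stieltjes_imag_im (r : ℝ) :
    (stieltjes (Complex.I * r)).im = ∫ t : ℝ, t * r / (1 + t ^ 2 * r ^ 2) ∂productLaw := by
  rw [stieltjes, im_integral (integrable_cauchyKernel_imag r)]
  simp_rw [cauchyKernel_imag_im]

theorem stieltjes_imag_re_nonneg (r : ℝ) : 0 ≤ (stieltjes (Complex.I * r)).re := by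
  rw [stieltjes_imag_re]
  exact integral_nonneg fun t => by positivity

theorem stieltjes_imag_re_anti {r s : ℝ} (hr : 0 ≤ r) (h : r ≤ s) :
    (stieltjes (Complex.I * s)).re ≤ (stieltjes (Complex.I * r)).re := by
  rw [stieltjes_imag_re, stieltjes_imag_re]
  refine integral_mono_productLaw (integrable_cauchyKernel_imag_re s)
    (integrable_cauchyKernel_imag_re r) fun t ht => ?_
  gcongr

/-- The function `u / (1 + u²)` increases on `[0, 1]`, and `u = t r` stays in this interval. -/
theorem stieltjes_imag_im_mono {r s : ℝ} (hr : 0 ≤ r) (h : r ≤ s) (hs : s ≤ 1) :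
    (stieltjes (Complex.I * r)).im ≤ (stieltjes (Complex.I * s)).im := by
  rw [stieltjes_imag_im, stieltjes_imag_im]
  refine integral_mono_productLaw (integrable_cauchyKernel_imag_im r)
    (integrable_cauchyKernel_imag_im s) fun t ht => ?_
  obtain ⟨h1, h2⟩ := ht
  rw [div_le_div_iff₀ (by positivity) (by positivity)]
  have h3 : t * t ≤ 1 := by nlinarith
  have h4 : r * s ≤ 1 := by nlinarith
  have h5 : (t * t) * (r * s) ≤ 1 := mul_le_one₀ h3 (by nlinarith) h4
  have h6 : 0 ≤ t * (s - r) * (1 - (t * t) * (r * s)) :=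
    mul_nonneg (mul_nonneg h1.le (sub_nonneg.2 h)) (sub_nonneg.2 h5)
  linear_combination h6

theorem norm_eq_sqrt_re_im (z : ℂ) : ‖z‖ = √(z.re ^ 2 + z.im ^ 2) := by
  rw [← norm_sq_eq, Real.sqrt_sq (norm_nonneg z)]

theorem psqrt_dilog_imag_re_sq {r : ℝ} (hr : 0 ≤ r) (hr1 : r ≤ 1) :
    (psqrt (dilog (Complex.I * r))).re ^ 2 =
      r * ((‖stieltjes (Complex.I * r)‖ - (stieltjes (Complex.I * r)).im) / 2) := by
  have hn : ‖Complex.I * (r : ℂ)‖ = r := by simp [abs_of_nonneg hr]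
  rw [psqrt_re_sq, dilog_eq_mul_stieltjes (hn.trans_le hr1), norm_mul, hn]
  simp
  ring

/-- The quantity `|w| - Im w` grows with `Re w ≥ 0` and falls with `Im w`. As `r` grows, the
Stieltjes transform at `ir` moves in the decreasing direction in both coordinates. -/
theorem norm_sub_im_le {z w : ℂ} (h0 : 0 ≤ w.re) (h1 : w.re ≤ z.re) (h2 : z.im ≤ w.im) :
    ‖w‖ - w.im ≤ ‖z‖ - z.im := by
  have h3 := Complex.im_le_norm z
  have h4 := norm_sq_eq z
  have h5 : ‖w‖ ≤ ‖z‖ + (w.im - z.im) := by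
    refine le_of_sq_le_sq ?_ (by linarith [norm_nonneg z])
    rw [norm_sq_eq]
    nlinarith [mul_nonneg (sub_nonneg.2 h2) (sub_nonneg.2 h3), mul_self_le_mul_self h0 h1]
  linarith

theorem summable_real_dilog {x : ℝ} (h0 : 0 ≤ x) (h1 : x ≤ 1) :
    Summable fun n : ℕ => x ^ n / ((n : ℝ) + 1) ^ 2 := by
  refine Summable.of_nonneg_of_le (fun n => by positivity) (fun n => ?_) summable_one_div_succ_sq
  gcongr
  exact pow_le_one₀ h0 h1

theorem psqrt_dilog_ofReal_re_sq {x : ℝ} (hx : 0 ≤ x) :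
    (psqrt (dilog x)).re ^ 2 = x * ∑' n : ℕ, x ^ n / ((n : ℝ) + 1) ^ 2 := by
  have h : 0 ≤ ∑' n : ℕ, x ^ (n + 1) / ((n : ℝ) + 1) ^ 2 :=
    tsum_nonneg fun n => by positivity
  rw [psqrt_re_sq, dilog_ofReal, Complex.norm_real, Complex.ofReal_re, Real.norm_of_nonneg h,
    ← tsum_mul_left, add_self_div_two]
  congr 1; ext n; ring

/-- The difference of `f₁(ir)²` and `f₂(r)²`, divided by `r`. -/
noncomputable def axisDiff (r : ℝ) : ℝ :=
  ((psqrt (dilog (Complex.I * r))).re ^ 2 - (psqrt (dilog ((r ^ 2 : ℝ) : ℂ))).re ^ 2 / 4) / r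

theorem axisDiff_eq {r : ℝ} (hr : 0 < r) (hr1 : r ≤ 1) : axisDiff r =
    (‖stieltjes (Complex.I * r)‖ - (stieltjes (Complex.I * r)).im) / 2 -
      r * (∑' n : ℕ, (r ^ 2) ^ n / ((n : ℝ) + 1) ^ 2) / 4 := by
  rw [axisDiff, psqrt_dilog_imag_re_sq hr.le hr1, psqrt_dilog_ofReal_re_sq (sq_nonneg r)]
  field_simp

/-- The Stieltjes term is only shown to be weakly decreasing; strictness comes from the factor `r`
in the subtracted series. -/
theorem axisDiff_strictAntiOn : StrictAntiOn axisDiff (Ioc 0 1) := by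
  rintro r ⟨hr0, hr1⟩ s ⟨hs0, hs1⟩ h
  rw [axisDiff_eq hr0 hr1, axisDiff_eq hs0 hs1]
  have h1 := norm_sub_im_le (stieltjes_imag_re_nonneg s) (stieltjes_imag_re_anti hr0.le h.le)
    (stieltjes_imag_im_mono hr0.le h.le hs1)
  have hs2 := summable_real_dilog (sq_nonneg s) (pow_le_one₀ hs0.le hs1)
  have h2 : ∑' n : ℕ, (r ^ 2) ^ n / ((n : ℝ) + 1) ^ 2 ≤
      ∑' n : ℕ, (s ^ 2) ^ n / ((n : ℝ) + 1) ^ 2 := by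
    refine Summable.tsum_le_tsum (fun n => ?_)
      (summable_real_dilog (sq_nonneg r) (pow_le_one₀ hr0.le hr1)) hs2
    gcongr
  have h3 : 0 < ∑' n : ℕ, (s ^ 2) ^ n / ((n : ℝ) + 1) ^ 2 :=
    hs2.tsum_pos (fun n => by positivity) 0 (by simp)
  nlinarith

theorem axisDiff_half_pos : 0 < axisDiff (1 / 2) := by
  have hn : ‖Complex.I * ((1 / 2 : ℝ) : ℂ)‖ = 1 / 2 := by simp
  have h1 := psqrt_dilog_re_sq_ge (z := Complex.I * ((1 / 2 : ℝ) : ℂ)) (by rw [hn]; norm_num)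
    (by simp)
  have hn2 : ‖(((1 / 2 : ℝ) ^ 2 : ℝ) : ℂ)‖ = 1 / 4 := by
    rw [Complex.norm_real]; norm_num
  have h2 := psqrt_dilog_re_sq_le (z := (((1 / 2 : ℝ) ^ 2 : ℝ) : ℂ)) (by rw [hn2]; norm_num)
  rw [hn] at h1
  rw [hn2] at h2
  rw [axisDiff]
  refine div_pos ?_ (by norm_num)
  linarith

/-- Truncated geometric series bound the kernels at `i`: `1 / (1 + t²) ≤ 1 - t² + t⁴` has mean bound
`209/225`, and `t / (1 + t²) ≥ t - t³` has mean bound `3/16`. Then `(19/20 - 3/16) / 2 ≈ 0.381` lies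
below `π² / 24 ≈ 0.411`. -/
theorem axisDiff_one_neg : axisDiff 1 < 0 := by
  rw [axisDiff_eq one_pos le_rfl]
  have h1 : ∑' n : ℕ, ((1 : ℝ) ^ 2) ^ n / ((n : ℝ) + 1) ^ 2 = Real.pi ^ 2 / 6 := by
    simpa using tsum_one_div_succ_sq
  have hA : (stieltjes (Complex.I * (1 : ℝ))).re ≤ 209 / 225 := by
    have i : Integrable (fun t : ℝ => 1 - t ^ 2 + t ^ 4) productLaw :=
      ((integrable_const 1).sub (integrable_pow_productLaw 2)).add (integrable_pow_productLaw 4)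
    have e : ∫ t : ℝ, (1 - t ^ 2 + t ^ 4) ∂productLaw = 209 / 225 := by
      have i0 : Integrable (fun t : ℝ => 1 - t ^ 2) productLaw :=
        (integrable_const 1).sub (integrable_pow_productLaw 2)
      rw [integral_add i0 (integrable_pow_productLaw 4), integral_sub (integrable_const 1)
        (integrable_pow_productLaw 2), integral_pow_productLaw, integral_pow_productLaw]
      simp; norm_num
    rw [stieltjes_imag_re, ← e]
    refine integral_mono_productLaw (integrable_cauchyKernel_imag_re 1) i fun t ht => ?_
    rw [div_le_iff₀ (by positivity)]
    nlinarith [pow_pos ht.1 6]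
  have hB : 3 / 16 ≤ (stieltjes (Complex.I * (1 : ℝ))).im := by
    have i : Integrable (fun t : ℝ => t ^ 1 - t ^ 3) productLaw :=
      (integrable_pow_productLaw 1).sub (integrable_pow_productLaw 3)
    have e : ∫ t : ℝ, (t ^ 1 - t ^ 3) ∂productLaw = 3 / 16 := by
      rw [integral_sub (integrable_pow_productLaw 1) (integrable_pow_productLaw 3),
        integral_pow_productLaw, integral_pow_productLaw]
      norm_num
    rw [stieltjes_imag_im, ← e]
    refine integral_mono_productLaw i (integrable_cauchyKernel_imag_im 1) fun t ht => ?_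
    rw [le_div_iff₀ (by positivity)]
    nlinarith [pow_pos ht.1 5]
  have h2 := norm_sub_im_le (z := ⟨209 / 225, 3 / 16⟩) (stieltjes_imag_re_nonneg 1) hA hB
  have h3 : ‖(⟨209 / 225, 3 / 16⟩ : ℂ)‖ ≤ 19 / 20 := by
    rw [norm_eq_sqrt_re_im]
    refine Real.sqrt_le_iff.2 ⟨by norm_num, by norm_num⟩
  rw [h1]
  simp only at h2
  nlinarith [Real.pi_gt_d2]

theorem continuousOn_axisDiff : ContinuousOn axisDiff (Icc (1 / 2) 1) := by
  have hd : ∀ g : ℝ → ℂ, Continuous g → (∀ r ∈ Icc (1 / 2 : ℝ) 1, ‖g r‖ ≤ 1) →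
      ContinuousOn (fun r => (psqrt (dilog (g r))).re) (Icc (1 / 2) 1) := fun g hg h =>
    continuous_psqrt_re.comp_continuousOn
      (continuousOn_dilog.comp hg.continuousOn fun r hr => mem_closedBall_zero_iff.2 (h r hr))
  refine ContinuousOn.div (((hd _ (by fun_prop) ?_).pow 2).sub
    (((hd _ (by fun_prop) ?_).pow 2).div_const 4)) continuousOn_id ?_
  · rintro r ⟨h1, h2⟩
    simp only [norm_mul, Complex.norm_I, Complex.norm_real, one_mul]
    rwa [Real.norm_of_nonneg (by linarith)]
  · rintro r ⟨h1, h2⟩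
    rw [Complex.norm_real, Real.norm_of_nonneg (sq_nonneg r)]
    exact pow_le_one₀ (by linarith) h2
  · rintro r ⟨h1, h2⟩
    exact ne_of_gt (lt_of_lt_of_le (by norm_num) h1)

/-- The function `f₁(ir)² - f₂(r)²` changes sign exactly once on `(0, 1]`. -/
theorem exists_axisDiff_sign : ∃ β : ℝ, 0 < β ∧ β < 1 ∧ axisDiff β = 0 ∧
    (∀ r, 0 < r → r < β → 0 < axisDiff r) ∧ (∀ r, β < r → r ≤ 1 → axisDiff r < 0) := by
  obtain ⟨β, ⟨h1, h2⟩, h3⟩ := intermediate_value_Icc' (by norm_num) continuousOn_axisDiff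
    ⟨axisDiff_one_neg.le, axisDiff_half_pos.le⟩
  have h4 : β ≠ 1 := fun h => by
    have := axisDiff_one_neg
    rw [← h, h3] at this
    exact this.false
  have h0 : 0 < β := lt_of_lt_of_le (by norm_num) h1
  refine ⟨β, h0, lt_of_le_of_ne h2 h4, h3, fun r hr hrβ => ?_, fun r hr hr1 => ?_⟩
  · rw [← h3]
    exact axisDiff_strictAntiOn ⟨hr, hrβ.le.trans h2⟩ ⟨h0, h2⟩ hrβ
  · rw [← h3]
    exact axisDiff_strictAntiOn ⟨h0, h2⟩ ⟨h0.trans hr, hr1⟩ hr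

/-! ### The phase functions of the odd-part partition polynomials in closed form -/

theorem expk_add (k : ℕ) (x y : ℤ) : expk k (x + y) = expk k x * expk k y := by
  rw [expk, expk, expk, ← Complex.exp_add]; push_cast; ring_nf

@[simp] theorem expk_zero (k : ℕ) : expk k 0 = 1 := by simp [expk]

theorem expk_mul_natCast (k : ℕ) (x : ℤ) (n : ℕ) : expk k (x * n) = expk k x ^ n := by
  rw [expk, expk, ← Complex.exp_nat_mul]; push_cast; ring_nf

theorem expk_eq_one_iff {k : ℕ} (hk : 0 < k) (x : ℤ) : expk k x = 1 ↔ (k : ℤ) ∣ x := by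
  have hk' : (k : ℂ) ≠ 0 := by exact_mod_cast hk.ne'
  rw [expk, Complex.exp_eq_one_iff]
  constructor
  · rintro ⟨n, hn⟩
    refine ⟨n, ?_⟩
    have h2 : (2 * Real.pi * Complex.I : ℂ) ≠ 0 := Complex.two_pi_I_ne_zero
    have h3 : (2 * Real.pi * Complex.I : ℂ) * x = (2 * Real.pi * Complex.I) * (k * n) := by
      rw [div_eq_iff hk'] at hn
      rw [hn]; ring
    exact_mod_cast mul_left_cancel₀ h2 h3
  · rintro ⟨n, rfl⟩
    refine ⟨n, ?_⟩
    push_cast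
    field_simp

theorem expk_congr {k : ℕ} (hk : 0 < k) {x y : ℤ} (h : (k : ℤ) ∣ x - y) :
    expk k x = expk k y := by
  have := expk_add k (x - y) y
  rwa [sub_add_cancel, (expk_eq_one_iff hk _).2 h, one_mul] at this

theorem sum_expk_mul {k : ℕ} (hk : 0 < k) (x : ℤ) :
    ∑ t ∈ Finset.Icc 1 k, expk k (x * (t : ℤ)) = if (k : ℤ) ∣ x then (k : ℂ) else 0 := by
  have e1 : ∑ t ∈ Finset.Icc 1 k, expk k (x * (t : ℤ)) =
      ∑ t ∈ Finset.range k, expk k x ^ (t + 1) := by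
    rw [Finset.range_eq_Ico, Finset.sum_Ico_add' (fun t => expk k x ^ t) 0 k 1]
    exact Finset.sum_congr (by ext; simp) fun t _ => expk_mul_natCast k x t
  rw [e1]
  split_ifs with h
  · simp [(expk_eq_one_iff hk x).2 h]
  · have h1 : expk k x ≠ 1 := fun h2 => h ((expk_eq_one_iff hk x).1 h2)
    simp_rw [pow_succ]
    rw [← Finset.sum_mul, geom_sum_eq h1, ← expk_mul_natCast,
      (expk_eq_one_iff hk _).2 (Dvd.intro_left x rfl)]
    simp

/-- The residue at `1` of the Dirichlet series of a periodic function is its mean. -/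
theorem tendsto_dirichletD_odd (t : ℕ) {k : ℕ} (hk : 0 < k) :
    Tendsto (fun s : ℂ => (s - 1) * dirichletD oddExponent t k s) (𝓝[{s : ℂ | 1 < s.re}] 1)
      (𝓝 (∑ m ∈ Finset.range (2 * k), (oddExponent m : ℂ) * expk k (m * t) / (2 * k : ℕ))) := by
  have : NeZero (2 * k) := ⟨by omega⟩
  -- The period `2k` serves both parity, of period 2, and `m ↦ e_k(m t)`, of period `k`.
  let Φ : ZMod (2 * k) → ℂ := fun j => (oddExponent j.val : ℂ) * expk k (j.val * t)
  have hΦ : ∀ m : ℕ, Φ m = (oddExponent m : ℂ) * expk k (m * t) := by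
    intro m
    simp only [Φ, ZMod.val_natCast]
    congr 1
    · have : Odd (m % (2 * k)) ↔ Odd m := by
        rw [Nat.odd_iff, Nat.odd_iff, Nat.mod_mul_right_mod]
      simp [oddExponent, this]
    · refine expk_congr hk ?_
      rw [← sub_mul]
      refine Dvd.dvd.mul_right ?_ _
      have h1 : ((2 * k : ℕ) : ℤ) ∣ ((m % (2 * k) : ℕ) : ℤ) - m := by
        rw [← neg_sub, dvd_neg, Int.natCast_mod]
        exact Int.dvd_self_sub_emod
      exact dvd_trans ⟨2, by push_cast; ring⟩ h1
  have h := ZMod.LFunction_residue_one Φ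
  have hsum : ∑ j, Φ j / ((2 * k : ℕ) : ℂ) =
      ∑ m ∈ Finset.range (2 * k), (oddExponent m : ℂ) * expk k (m * t) / (2 * k : ℕ) := by
    simp_rw [← hΦ]
    refine Finset.sum_bij' (fun j _ => j.val) (fun m _ => (m : ZMod (2 * k))) ?_ ?_ ?_ ?_ ?_
    · intro j _; exact Finset.mem_range.2 (ZMod.val_lt j)
    · simp
    · intro j _; simp
    · intro m hm; exact ZMod.val_cast_of_lt (Finset.mem_range.1 hm)
    · intro j _; simp
  rw [hsum] at h
  refine (h.mono_left (nhdsWithin_mono 1 fun s hs h1 => ?_)).congr' ?_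
  · rw [mem_ofPred_eq, mem_singleton_iff.1 h1, Complex.one_re] at hs
    exact lt_irrefl _ hs
  · filter_upwards [self_mem_nhdsWithin] with s hs
    rw [ZMod.LFunction_eq_LSeries Φ hs, dirichletD]
    simp_rw [hΦ]

/-- The point 1 lies on the edge of the half-plane; nontriviality of this filter makes the limit
unique, so that `limUnder` returns it. -/
theorem neBot_halfPlane_one : (𝓝[{s : ℂ | 1 < s.re}] 1).NeBot := by
  refine mem_closure_iff_nhdsWithin_neBot.1 ?_
  rw [Complex.closure_setOfPred_lt_re]
  simp

theorem resD_odd (t : ℕ) {k : ℕ} (hk : 0 < k) : resD oddExponent t k =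
    ∑ m ∈ Finset.range (2 * k), (oddExponent m : ℂ) * expk k (m * t) / (2 * k : ℕ) :=
  haveI := neBot_halfPlane_one
  (tendsto_dirichletD_odd t hk).limUnder_eq

/-- Orthogonality in `t` inverts the Fourier transform: `c_k(j)` is the density of the odd integers
congruent to `j` modulo `k`. -/
theorem coeffC_odd_eq_sum (j : ℕ) {k : ℕ} (hk : 0 < k) : coeffC oddExponent k j =
    ∑ m ∈ Finset.range (2 * k),
      (oddExponent m : ℂ) * (if (k : ℤ) ∣ (m : ℤ) - j then 1 / (2 * k : ℂ) else 0) := by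
  have hk' : (k : ℂ) ≠ 0 := by exact_mod_cast hk.ne'
  rw [coeffC]
  simp_rw [resD_odd _ hk, Finset.mul_sum]
  rw [Finset.sum_comm]
  refine Finset.sum_congr rfl fun m _ => ?_
  have h := sum_expk_mul hk ((m : ℤ) - j)
  have e : ∀ t : ℕ, 1 / (k : ℂ) * (expk k (-((t : ℤ) * j)) *
      ((oddExponent m : ℂ) * expk k (m * t) / (2 * k : ℕ))) =
      (oddExponent m : ℂ) / (k * (2 * k)) * expk k (((m : ℤ) - j) * t) := by
    intro t
    rw [show ((m : ℤ) - j) * t = -((t : ℤ) * j) + m * t by ring, expk_add]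
    push_cast
    field_simp
  simp_rw [e]
  rw [← Finset.mul_sum, h]
  split_ifs
  · field_simp
  · simp

theorem sum_coeffC_odd_mul {k : ℕ} (hk : 0 < k) (x : ℤ) :
    ∑ j ∈ Finset.Icc 1 k, coeffC oddExponent k j * expk k (j * x) =
      1 / (2 * k : ℂ) * ∑ m ∈ Finset.range (2 * k), (oddExponent m : ℂ) * expk k (m * x) := by
  simp_rw [coeffC_odd_eq_sum _ hk, Finset.sum_mul]
  rw [Finset.sum_comm, Finset.mul_sum]
  refine Finset.sum_congr rfl fun m _ => ?_
  -- Residues are represented in `1, ..., k`, so the class of 0 is represented by `k`.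
  obtain ⟨j, hj, hmj⟩ : ∃ j ∈ Finset.Icc 1 k, (k : ℤ) ∣ (m : ℤ) - j := by
    rcases Nat.eq_zero_or_pos (m % k) with h0 | h0
    · refine ⟨k, by simp; omega, ?_⟩
      have : (k : ℤ) ∣ m := by exact_mod_cast Nat.dvd_of_mod_eq_zero h0
      exact dvd_sub this dvd_rfl
    · refine ⟨m % k, by simp; exact ⟨h0, (Nat.mod_lt _ hk).le⟩, ?_⟩
      rw [Int.natCast_mod]
      exact Int.dvd_self_sub_emod
  rw [Finset.sum_eq_single_of_mem j hj]
  · rw [if_pos hmj, expk_congr hk (x := (j : ℤ) * x) (y := m * x)]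
    · ring
    · rw [← sub_mul, ← neg_sub]
      exact (hmj.neg_right).mul_right x
  · intro i hi hij
    rw [if_neg, mul_zero, zero_mul]
    intro hmi
    refine hij ?_
    have h1 : (k : ℤ) ∣ (i : ℤ) - j := by
      have := dvd_sub hmj hmi
      rwa [sub_sub_sub_cancel_left] at this
    rw [Finset.mem_Icc] at hi hj
    have h2 : |(i : ℤ) - j| < k := by rw [abs_lt]; omega
    have := Int.eq_zero_of_abs_lt_dvd h1 h2
    omega

theorem sum_range_two_mul_odd (k : ℕ) (f : ℕ → ℂ) :
    ∑ m ∈ Finset.range (2 * k), (oddExponent m : ℂ) * f m =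
      ∑ i ∈ Finset.range k, f (2 * i + 1) := by
  induction k with
  | zero => simp
  | succ k ih =>
    rw [mul_add, mul_one, Finset.sum_range_succ, Finset.sum_range_succ, ih,
      Finset.sum_range_succ]
    simp [oddExponent]

/-- The weight with which the power `z ^ n` enters the odd-part phase function of level `k`. -/
theorem sum_coeffC_odd_mul_eq {k : ℕ} (hk : 0 < k) (x : ℤ) :
    ∑ j ∈ Finset.Icc 1 k, coeffC oddExponent k j * expk k (j * x) =
      if (k : ℤ) ∣ 2 * x then expk k x / 2 else 0 := by
  have hk' : (k : ℂ) ≠ 0 := by exact_mod_cast hk.ne'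
  rw [sum_coeffC_odd_mul hk, sum_range_two_mul_odd k fun m => expk k (m * x)]
  -- Over the odd numbers `2 i + 1` the sum is geometric with ratio `e_k(2x)`, a `k`-th root of
  -- unity: it vanishes unless the ratio is 1.
  have e : ∀ i : ℕ, expk k (((2 * i + 1 : ℕ) : ℤ) * x) = expk k x * expk k (2 * x) ^ i := by
    intro i
    rw [← expk_mul_natCast, ← expk_add]
    push_cast; ring_nf
  simp_rw [e]
  rw [← Finset.mul_sum]
  split_ifs with h
  · rw [(expk_eq_one_iff hk _).2 h]
    simp
    field_simp
  · have h1 : expk k (2 * x) ≠ 1 := fun h2 => h ((expk_eq_one_iff hk _).1 h2)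
    rw [geom_sum_eq h1, ← expk_mul_natCast, (expk_eq_one_iff hk _).2 (Dvd.intro_left _ rfl)]
    simp

theorem sum_coeffC_odd_dilog {k : ℕ} (hk : 0 < k) (h : ℕ) {z : ℂ} (hz : ‖z‖ ≤ 1) :
    ∑ j ∈ Finset.Icc 1 k, coeffC oddExponent k j * dilog (expk k (j * h) * z) =
      ∑' n : ℕ, (if (k : ℤ) ∣ 2 * (h * (n + 1 : ℕ)) then expk k (h * (n + 1 : ℕ)) / 2 else 0) *
        (z ^ (n + 1) / ((n : ℂ) + 1) ^ 2) := by
  have hn : ∀ x : ℤ, ‖expk k x‖ = 1 := by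
    intro x
    have : (2 * Real.pi * Complex.I * x / k : ℂ) = ((2 * Real.pi * x / k : ℝ) : ℂ) * Complex.I := by
      push_cast; ring
    rw [expk, this, Complex.norm_exp_ofReal_mul_I]
  have hs : ∀ j : ℕ, HasSum (fun n : ℕ => coeffC oddExponent k j *
      ((expk k (j * h) * z) ^ (n + 1) / ((n : ℂ) + 1) ^ 2))
      (coeffC oddExponent k j * dilog (expk k (j * h) * z)) := fun j =>
    ((summable_dilog (by rwa [norm_mul, hn, one_mul])).hasSum).mul_left _
  rw [← (hasSum_sum fun j (_ : j ∈ Finset.Icc 1 k) => hs j).tsum_eq]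
  congr 1
  ext n
  rw [← sum_coeffC_odd_mul_eq hk, Finset.sum_mul]
  refine Finset.sum_congr rfl fun j _ => ?_
  rw [mul_pow, ← expk_mul_natCast, mul_assoc (j : ℤ)]
  ring

/-- The index `n` stands for the power `n + 1`, so the multiples of `d` sit at the indices `d (l +
1) - 1`. -/
theorem tsum_multiples {d : ℕ} (hd : 0 < d) {f : ℕ → ℂ} (hf : ∀ n, ¬ d ∣ n + 1 → f n = 0) :
    ∑' n, f n = ∑' l, f (d * (l + 1) - 1) := by
  have hsub : ∀ l, d * (l + 1) - 1 + 1 = d * (l + 1) := fun l =>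
    Nat.sub_add_cancel (Nat.mul_pos hd l.succ_pos)
  have hinj : Function.Injective fun l => d * (l + 1) - 1 := by
    intro a b hab
    have h1 : d * (a + 1) = d * (b + 1) := by rw [← hsub a, ← hsub b]; exact congrArg (· + 1) hab
    have := Nat.eq_of_mul_eq_mul_left hd h1
    omega
  refine (hinj.tsum_eq fun n hn => ?_).symm
  have h1 : d ∣ n + 1 := by
    by_contra h
    exact hn (hf n h)
  obtain ⟨c, hc⟩ := h1
  have hc0 : c ≠ 0 := by rintro rfl; omega
  refine ⟨c - 1, ?_⟩
  have : c - 1 + 1 = c := by omega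
  simp only [this, ← hc, Nat.add_sub_cancel]

/-- Used with `d = k`, `ε = 1` for odd `k`, and with `d = k / 2`, `ε = -1` for even `k`. -/
theorem sum_coeffC_odd_dilog_of_multiples {k : ℕ} (hk : 0 < k) (h : ℕ) {z : ℂ} (hz : ‖z‖ ≤ 1)
    {d : ℕ} (hd : 0 < d) {ε : ℂ} (hdvd : ∀ n : ℕ, (k : ℤ) ∣ 2 * (h * (n : ℤ)) ↔ d ∣ n)
    (hε : expk k (h * d) = ε) :
    ∑ j ∈ Finset.Icc 1 k, coeffC oddExponent k j * dilog (expk k (j * h) * z) =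
      1 / (2 * (d : ℂ) ^ 2) * dilog (ε * z ^ d) := by
  have hd' : (d : ℂ) ≠ 0 := by exact_mod_cast hd.ne'
  have hsub : ∀ l, d * (l + 1) - 1 + 1 = d * (l + 1) := fun l =>
    Nat.sub_add_cancel (Nat.mul_pos hd l.succ_pos)
  rw [sum_coeffC_odd_dilog hk h hz, tsum_multiples hd, dilog, ← tsum_mul_left]
  · congr 1
    ext l
    rw [hsub, if_pos ((hdvd _).2 (Dvd.intro _ rfl))]
    have e1 : ((d * (l + 1) - 1 : ℕ) : ℂ) + 1 = d * (l + 1) := by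
      have := hsub l
      exact_mod_cast this
    have e2 : expk k (h * ((d * (l + 1) : ℕ) : ℤ)) = ε ^ (l + 1) := by
      rw [← hε, ← expk_mul_natCast]; push_cast; ring_nf
    have e3 : (l : ℂ) + 1 ≠ 0 := Nat.cast_add_one_ne_zero l
    rw [e1, e2, mul_pow, mul_pow, ← pow_mul]
    field_simp
  · intro n hn
    rw [if_neg (fun h1 => hn ((hdvd _).1 h1)), zero_mul]

theorem sqrt_two_mul_psqrt {d : ℕ} (w : ℂ) :
    ((√2 : ℝ) : ℂ) * psqrt (1 / (2 * (d : ℂ) ^ 2) * w) = 1 / (d : ℂ) * psqrt w := by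
  have e : (1 / (2 * (d : ℂ) ^ 2)) = ((1 / 2 * (1 / (d : ℝ)) ^ 2 : ℝ) : ℂ) := by
    push_cast; ring
  rw [e, psqrt_ofReal_mul (by positivity), ← mul_assoc, ← Complex.ofReal_mul,
    ← Real.sqrt_mul (by norm_num), ← mul_assoc, mul_one_div_cancel two_ne_zero, one_mul,
    Real.sqrt_sq (by positivity)]
  push_cast
  rfl

theorem sqrt_two_mul_phaseFunction {h k : ℕ} (h1 : 1 ≤ h) (hhk : h ≤ k) (hc : Nat.Coprime h k)
    {z : ℂ} (hz : ‖z‖ ≤ 1) :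
    ((√2 : ℝ) : ℂ) * phaseFunction oddExponent h k z = oddL k z := by
  have hk : 0 < k := by omega
  rw [phaseFunction, oddL]
  split_ifs with hodd
  · have hdvd : ∀ n : ℕ, (k : ℤ) ∣ 2 * (h * (n : ℤ)) ↔ k ∣ n := by
      intro n
      have e1 : k ∣ 2 * (h * n) ↔ k ∣ h * n :=
        Nat.Coprime.dvd_mul_left (Nat.coprime_two_right.2 hodd)
      have e2 : k ∣ h * n ↔ k ∣ n := Nat.Coprime.dvd_mul_left hc.symm
      exact_mod_cast e1.trans e2
    rw [sum_coeffC_odd_dilog_of_multiples hk h hz hk hdvd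
      ((expk_eq_one_iff hk _).2 (Dvd.intro_left _ rfl)), one_mul, sqrt_two_mul_psqrt]
  · rw [Nat.not_odd_iff_even] at hodd
    obtain ⟨d, rfl⟩ := hodd
    have hd : 0 < d := by omega
    have hd2 : (d + d) / 2 = d := by omega
    have hodd : Odd h := Nat.coprime_two_right.1
      (Nat.Coprime.coprime_dvd_right ⟨d, by ring⟩ hc)
    have hcd : Nat.Coprime h d := Nat.Coprime.coprime_dvd_right ⟨2, by ring⟩ hc
    have hdvd : ∀ n : ℕ, ((d + d : ℕ) : ℤ) ∣ 2 * (h * (n : ℤ)) ↔ d ∣ n := by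
      intro n
      have e1 : 2 * d ∣ 2 * (h * n) ↔ d ∣ h * n := Nat.mul_dvd_mul_iff_left two_pos
      have e2 : d ∣ h * n ↔ d ∣ n := Nat.Coprime.dvd_mul_left hcd.symm
      rw [← two_mul]
      exact_mod_cast e1.trans e2
    -- Being coprime to an even number, `h` is odd, and `e_{2d}(h d) = (-1) ^ h`.
    have hε : expk (d + d) (h * d) = -1 := by
      have hd' : (d : ℂ) ≠ 0 := by exact_mod_cast hd.ne'
      have e : (2 * Real.pi * Complex.I * ((h * d : ℤ) : ℂ) / ((d + d : ℕ) : ℂ)) =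
          (h : ℂ) * (Real.pi * Complex.I) := by
        push_cast
        field_simp
        ring
      rw [expk, e, Complex.exp_nat_mul, Complex.exp_pi_mul_I, hodd.neg_one_pow]
    rw [sum_coeffC_odd_dilog_of_multiples hk h hz hd hdvd hε, hd2, neg_one_mul,
      sqrt_two_mul_psqrt]

/-! ### The real parts of the phase functions -/

/-- The real part of `L_k`. -/
noncomputable def reL (k : ℕ) (z : ℂ) : ℝ := (oddL k z).re

theorem reL_one (z : ℂ) : reL 1 z = (psqrt (dilog z)).re := by
  simp [reL, oddL]

theorem reL_two (z : ℂ) : reL 2 z = (psqrt (dilog (-z))).re := by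
  have h : ¬ Odd 2 := by decide
  simp [reL, oddL, h]

theorem reL_four (z : ℂ) : reL 4 z = 1 / 2 * (psqrt (dilog (-z ^ 2))).re := by
  have h : ¬ Odd 4 := by decide
  rw [reL, oddL, if_neg h, show 4 / 2 = 2 from rfl]
  have : (1 / ((2 : ℕ) : ℂ)) = ((1 / 2 : ℝ) : ℂ) := by norm_num
  rw [this, Complex.re_ofReal_mul]

theorem reL_two_eq_neg (z : ℂ) : reL 2 z = reL 1 (-z) := by rw [reL_two, reL_one]

theorem reL_one_neg (z : ℂ) : reL 1 (-z) = reL 2 z := (reL_two_eq_neg z).symm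

theorem reL_two_neg (z : ℂ) : reL 2 (-z) = reL 1 z := by rw [reL_two_eq_neg, neg_neg]

theorem reL_four_neg (z : ℂ) : reL 4 (-z) = reL 4 z := by rw [reL_four, reL_four, neg_sq]

theorem psqrt_dilog_conj_re (z : ℂ) :
    (psqrt (dilog (conj z))).re = (psqrt (dilog z)).re := by
  rw [dilog_conj, psqrt_re, psqrt_re]; simp

theorem reL_one_conj (z : ℂ) : reL 1 (conj z) = reL 1 z := by
  rw [reL_one, reL_one, psqrt_dilog_conj_re]

theorem reL_four_conj (z : ℂ) : reL 4 (conj z) = reL 4 z := by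
  rw [reL_four, reL_four, ← map_pow, ← map_neg, psqrt_dilog_conj_re]

theorem mem_unitDisk {z : ℂ} : z ∈ unitDisk ↔ ‖z‖ < 1 := mem_ball_zero_iff

theorem neg_mem_unitDisk {z : ℂ} : -z ∈ unitDisk ↔ z ∈ unitDisk := by
  rw [mem_unitDisk, mem_unitDisk, norm_neg]

theorem isOpen_unitDisk : IsOpen unitDisk := Metric.isOpen_ball

theorem continuousOn_psqrt_dilog_re {g : ℂ → ℂ} (hg : Continuous g)
    (h : ∀ z ∈ unitDisk, ‖g z‖ ≤ 1) :
    ContinuousOn (fun z => (psqrt (dilog (g z))).re) unitDisk :=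
  continuous_psqrt_re.comp_continuousOn
    (continuousOn_dilog.comp hg.continuousOn fun z hz => mem_closedBall_zero_iff.2 (h z hz))

theorem continuousOn_reL_one : ContinuousOn (reL 1) unitDisk := by
  rw [funext reL_one]
  exact continuousOn_psqrt_dilog_re continuous_id fun z hz => (mem_unitDisk.1 hz).le

theorem continuousOn_reL_two : ContinuousOn (reL 2) unitDisk := by
  rw [funext reL_two]
  exact continuousOn_psqrt_dilog_re continuous_neg fun z hz => by
    rw [norm_neg]; exact (mem_unitDisk.1 hz).le

theorem continuousOn_reL_four : ContinuousOn (reL 4) unitDisk := by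
  rw [funext reL_four]
  refine (continuousOn_psqrt_dilog_re (by fun_prop) fun z hz => ?_).const_mul _
  rw [norm_neg, norm_pow]
  exact pow_le_one₀ (norm_nonneg z) (mem_unitDisk.1 hz).le

theorem reL_nonneg (k : ℕ) (z : ℂ) : 0 ≤ reL k z := by
  have h : ∀ (j : ℕ) (w : ℂ), 0 ≤ (1 / (j : ℂ) * psqrt w).re := fun j w => by
    have : (1 / (j : ℂ)) = ((1 / j : ℝ) : ℂ) := by push_cast; rfl
    rw [this, Complex.re_ofReal_mul]
    exact mul_nonneg (by positivity) (psqrt_re_nonneg w)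
  rw [reL, oddL]
  split_ifs <;> exact h _ _

theorem reL_zero (k : ℕ) (hk : k ≠ 0) : reL k 0 = 0 := by
  have h0 : psqrt 0 = 0 := by simp [psqrt]
  rw [reL, oddL]
  split_ifs with h
  · simp [hk, h0]
  · have : k / 2 ≠ 0 := by
      rintro h1
      have : k = 1 := by omega
      exact h (this ▸ odd_one)
    simp [this, h0]

/-- For the remaining indices the prefactor is at most `1/3` (odd `k ≥ 3`, or even `k` with `k / 2 ≥
3`), and `(1/9) (5/3) = 5/27`. -/
theorem reL_sq_le {z : ℂ} (hz : ‖z‖ < 1) {k : ℕ} (h0 : k ≠ 0) (h1 : k ≠ 1) (h2 : k ≠ 2)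
    (h4 : k ≠ 4) : reL k z ^ 2 ≤ 5 / 27 * ‖z‖ := by
  have h : ∀ (j : ℕ) (w : ℂ), 3 ≤ j → ‖w‖ ≤ ‖z‖ →
      (1 / (j : ℂ) * psqrt (dilog w)).re ^ 2 ≤ 5 / 27 * ‖z‖ := fun j w hj hw => by
    have e : (1 / (j : ℂ)) = ((1 / j : ℝ) : ℂ) := by push_cast; rfl
    have hj' : (3 : ℝ) ≤ j := by exact_mod_cast hj
    have h5 := psqrt_dilog_re_sq_le (hw.trans hz.le)
    rw [e, Complex.re_ofReal_mul, mul_pow]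
    have h6 : (1 / (j : ℝ)) ^ 2 ≤ 1 / 9 := by
      rw [one_div_pow]
      exact one_div_le_one_div_of_le (by norm_num) (by nlinarith)
    calc (1 / (j : ℝ)) ^ 2 * (psqrt (dilog w)).re ^ 2 ≤ 1 / 9 * (5 / 3 * ‖z‖) :=
          mul_le_mul h6 (by linarith) (sq_nonneg _) (by norm_num)
      _ = 5 / 27 * ‖z‖ := by ring
  have hp : ∀ j : ℕ, j ≠ 0 → ‖z ^ j‖ ≤ ‖z‖ := fun j hj => by
    rw [norm_pow]
    exact pow_le_of_le_one (norm_nonneg z) hz.le hj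
  rw [reL, oddL]
  split_ifs with hodd
  · obtain ⟨m, rfl⟩ := hodd
    exact h _ _ (by omega) (hp _ h0)
  · rw [Nat.not_odd_iff_even] at hodd
    obtain ⟨m, rfl⟩ := hodd
    refine h _ _ (by omega) ?_
    rw [norm_neg]
    exact hp _ (by omega)

theorem reL_lt_of_sq_lt {k l : ℕ} {z w : ℂ} (h : reL k z ^ 2 < reL l w ^ 2) :
    reL k z < reL l w :=
  lt_of_pow_lt_pow_left₀ 2 (reL_nonneg l w) h

theorem reL_one_sq_ge {z : ℂ} (hz : ‖z‖ < 1) (h : 0 ≤ z.re) : 3 / 10 * ‖z‖ ≤ reL 1 z ^ 2 := by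
  rw [reL_one]; exact psqrt_dilog_re_sq_ge hz h

theorem reL_lt_one {z : ℂ} (hz : ‖z‖ < 1) (hz0 : z ≠ 0) (h : 0 ≤ z.re) {k : ℕ} (h0 : k ≠ 0)
    (h1 : k ≠ 1) (h2 : k ≠ 2) (h4 : k ≠ 4) : reL k z < reL 1 z := by
  have h5 := reL_one_sq_ge hz h
  have h6 := reL_sq_le hz h0 h1 h2 h4
  exact reL_lt_of_sq_lt (by linarith [norm_pos_iff.2 hz0])

theorem reL_lt_two {z : ℂ} (hz : ‖z‖ < 1) (hz0 : z ≠ 0) (h : z.re ≤ 0) {k : ℕ} (h0 : k ≠ 0)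
    (h1 : k ≠ 1) (h2 : k ≠ 2) (h4 : k ≠ 4) : reL k z < reL 2 z := by
  have h5 := reL_one_sq_ge (z := -z) (by rwa [norm_neg]) (by simpa using h)
  rw [norm_neg, reL_one_neg] at h5
  have h6 := reL_sq_le hz h0 h1 h2 h4
  exact reL_lt_of_sq_lt (by linarith [norm_pos_iff.2 hz0])

/-- Near the origin `(Re L₄)²` is of order `|z|²`, at most `5/12 |z|²`, against `3/10 |z|` for `Re
L₁`. -/
theorem reL_four_lt_one {z : ℂ} (hz : ‖z‖ < 1 / 2) (hz0 : z ≠ 0) (h : 0 ≤ z.re) :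
    reL 4 z < reL 1 z := by
  have hz0' := norm_pos_iff.2 hz0
  have h1 := reL_one_sq_ge (by linarith) h
  have h3 : ‖-z ^ 2‖ = ‖z‖ ^ 2 := by rw [norm_neg, norm_pow]
  have h2 := psqrt_dilog_re_sq_le (z := -z ^ 2) (by rw [h3]; nlinarith)
  refine reL_lt_of_sq_lt ?_
  rw [reL_four, mul_pow]
  rw [h3] at h2
  nlinarith

theorem reL_two_lt_one {z : ℂ} (hz : ‖z‖ < 1) (h : 0 < z.re) : reL 2 z < reL 1 z := by
  rw [reL_one, reL_two]; exact psqrt_dilog_neg_re_lt hz h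

theorem reL_one_lt_two {z : ℂ} (hz : ‖z‖ < 1) (h : z.re < 0) : reL 1 z < reL 2 z := by
  have := reL_two_lt_one (z := -z) (by rwa [norm_neg]) (by simpa using h)
  rwa [reL_one_neg, reL_two_neg] at this

/-- On the imaginary axis `-z` is the conjugate of `z`. -/
theorem reL_one_eq_two {z : ℂ} (h : z.re = 0) : reL 1 z = reL 2 z := by
  rw [reL_two_eq_neg, ← reL_one_conj]
  congr 1
  apply Complex.ext <;> simp [h]

theorem reL_two_lt_one_iff {z : ℂ} (hz : ‖z‖ < 1) : reL 2 z < reL 1 z ↔ 0 < z.re := by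
  refine ⟨fun h => ?_, reL_two_lt_one hz⟩
  by_contra! h1
  rcases h1.lt_or_eq with h2 | h2
  · exact lt_asymm h (reL_one_lt_two hz h2)
  · exact h.ne' (reL_one_eq_two h2)

theorem reL_two_le_one_iff {z : ℂ} (hz : ‖z‖ < 1) : reL 2 z ≤ reL 1 z ↔ 0 ≤ z.re := by
  have := reL_two_lt_one_iff (z := -z) (by rwa [norm_neg])
  rw [reL_one_neg, reL_two_neg, Complex.neg_re, neg_pos] at this
  rw [← not_lt, this, not_lt]

/-- For real `z`, `Li₂(-z²)` is real and nonpositive, so its principal root is purely imaginary and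
`Re L₄` vanishes. -/
theorem reL_four_lt_one_of_im_eq_zero {z : ℂ} (hz : ‖z‖ < 1) (h : 0 < z.re) (h0 : z.im = 0) :
    reL 4 z < reL 1 z := by
  have hz0 : z ≠ 0 := by rintro rfl; simp at h
  have h1 := reL_one_sq_ge hz h.le
  have h2 := norm_pos_iff.2 hz0
  have hz1 : z = (z.re : ℂ) := Complex.ext (by simp) (by simpa using h0)
  have h3 : reL 4 z ^ 2 = 0 := by
    have e : -z ^ 2 = ((-z.re ^ 2 : ℝ) : ℂ) := by rw [hz1]; push_cast; simp
    have hn : ‖-z ^ 2‖ < 1 := by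
      rw [norm_neg, norm_pow]; nlinarith [norm_nonneg z]
    have h5 : (dilog (-z ^ 2)).re ≤ 0 := by
      rw [dilog_eq_integral hn.le, re_integral (integrable_dilogKernel hn)]
      refine MeasureTheory.integral_nonpos_of_ae
        (ae_productLaw_mem.mono fun t ht => ?_)
      simp only [Pi.zero_apply]
      rw [dilogKernel_re]
      refine div_nonpos_of_nonpos_of_nonneg ?_ (normSq_pos hn.le ht).le
      rw [e, Complex.ofReal_re, Complex.ofReal_im]
      nlinarith [ht.1, sq_nonneg z.re, mul_nonneg ht.1.le (sq_nonneg (z.re ^ 2))]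
    have h6 : ‖dilog (-z ^ 2)‖ = -(dilog (-z ^ 2)).re := by
      have h7 : (dilog (-z ^ 2)).im = 0 := by rw [e, dilog_ofReal]; simp
      rw [norm_eq_sqrt_re_im, h7, zero_pow two_ne_zero, add_zero, Real.sqrt_sq_eq_abs,
        abs_of_nonpos h5]
    rw [reL_four, mul_pow, psqrt_re_sq, h6]
    ring
  exact reL_lt_of_sq_lt (by rw [h3]; linarith)

/-! ### The level set of `Re L₁` and `Re L₄` -/

/-- The open quarter disk. -/
def openQuadrant : Set ℂ := {z | z ∈ unitDisk ∧ 0 < z.re ∧ 0 < z.im}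

theorem isOpen_openQuadrant : IsOpen openQuadrant :=
  isOpen_unitDisk.inter ((isOpen_lt continuous_const Complex.continuous_re).inter
    (isOpen_lt continuous_const Complex.continuous_im))

theorem isPreconnected_openQuadrant : IsPreconnected openQuadrant :=
  ((convex_ball 0 1).inter ((convex_halfSpace_re_gt 0).inter
    (convex_halfSpace_im_gt 0))).isPreconnected

/-- The difference of `L₁` and `L₄`. -/
noncomputable def diffOneFour (z : ℂ) : ℂ :=
  psqrt (dilog z) - 1 / 2 * psqrt (dilog (-z ^ 2))

theorem diffOneFour_re (z : ℂ) : (diffOneFour z).re = reL 1 z - reL 4 z := by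
  have : (1 / 2 : ℂ) = ((1 / 2 : ℝ) : ℂ) := by norm_num
  rw [diffOneFour, Complex.sub_re, reL_one, reL_four, this, Complex.re_ofReal_mul]

theorem differentiableAt_dilog {z : ℂ} (hz : ‖z‖ < 1) : DifferentiableAt ℂ dilog z :=
  differentiableOn_dilog.differentiableAt (isOpen_unitDisk.mem_nhds (mem_unitDisk.2 hz))

/-- In the open quadrant `z` lies in the upper and `-z²` in the lower half-plane. The dilogarithm
preserves both, so its values avoid the cut of the principal root. -/
theorem analyticOnNhd_diffOneFour : AnalyticOnNhd ℂ diffOneFour openQuadrant := by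
  refine DifferentiableOn.analyticOnNhd (fun z hz => ?_) isOpen_openQuadrant
  obtain ⟨hz, hre, him⟩ := hz
  rw [mem_unitDisk] at hz
  have hz2 : ‖-z ^ 2‖ < 1 := by rw [norm_neg, norm_pow]; nlinarith [norm_nonneg z]
  have him2 : (-z ^ 2).im < 0 := by
    rw [Complex.neg_im, sq, Complex.mul_im]; nlinarith [mul_pos hre him]
  have d1 : DifferentiableAt ℂ (fun z => dilog z) z := differentiableAt_dilog hz
  have d2 : DifferentiableAt ℂ (fun z => dilog (-z ^ 2)) z :=
    DifferentiableAt.comp z (differentiableAt_dilog hz2) (by fun_prop)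
  have s1 : dilog z ∈ Complex.slitPlane := Or.inr (dilog_im_pos hz him).ne'
  have s2 : dilog (-z ^ 2) ∈ Complex.slitPlane := Or.inr (dilog_im_neg hz2 him2).ne
  have e1 := d1.cpow (differentiableAt_const (1 / 2 : ℂ)) s1
  have e2 := d2.cpow (differentiableAt_const (1 / 2 : ℂ)) s2
  exact (e1.sub (e2.const_mul (1 / 2))).differentiableWithinAt

/-- Open mapping. Local constancy would spread over the connected quadrant and force `Re L₁ = Re L₄`
at `(1 + i) / 10`, where `Re L₄ < Re L₁`. -/
theorem nhds_le_map_diffOneFour {z : ℂ} (hz : z ∈ openQuadrant) (h : reL 1 z = reL 4 z) :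
    𝓝 (diffOneFour z) ≤ map diffOneFour (𝓝 z) := by
  refine (analyticOnNhd_diffOneFour z hz).eventually_constant_or_nhds_le_map_nhds.resolve_left
    fun hc => ?_
  have h1 := analyticOnNhd_diffOneFour.eqOn_of_preconnected_of_eventuallyEq
    analyticOnNhd_const isPreconnected_openQuadrant hz hc
  have hw : ‖(⟨1 / 10, 1 / 10⟩ : ℂ)‖ < 1 / 2 := by
    rw [norm_eq_sqrt_re_im, Real.sqrt_lt' (by norm_num)]; norm_num
  have h2 := congrArg Complex.re (h1 (x := ⟨1 / 10, 1 / 10⟩)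
    ⟨mem_unitDisk.2 (hw.trans (by norm_num)), by norm_num, by norm_num⟩)
  rw [diffOneFour_re, diffOneFour_re, h, sub_self] at h2
  have h3 := reL_four_lt_one hw (by simp [Complex.ext_iff]) (by norm_num)
  linarith

theorem frequently_re_pos (w : ℂ) : ∃ᶠ v in 𝓝 w, w.re < v.re := by
  refine mem_closure_iff_frequently (s := {v : ℂ | w.re < v.re}).1 ?_
  rw [Complex.closure_setOfPred_lt_re]
  exact le_refl w.re

theorem frequently_re_neg (w : ℂ) : ∃ᶠ v in 𝓝 w, v.re < w.re := by
  refine mem_closure_iff_frequently (s := {v : ℂ | v.re < w.re}).1 ?_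
  rw [Complex.closure_setOfPred_re_lt]
  exact le_refl w.re

theorem frequently_of_mem_openQuadrant {z : ℂ} (hz : z ∈ openQuadrant)
    (h : reL 1 z = reL 4 z) :
    (∃ᶠ w in 𝓝 z, reL 4 w < reL 1 w) ∧ ∃ᶠ w in 𝓝 z, reL 1 w < reL 4 w := by
  have hm := nhds_le_map_diffOneFour hz h
  have h0 : (diffOneFour z).re = 0 := by rw [diffOneFour_re, h, sub_self]
  constructor
  · have := frequently_map.1 ((frequently_re_pos (diffOneFour z)).filter_mono hm)
    refine this.mono fun w hw => ?_
    rw [h0, diffOneFour_re] at hw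
    linarith
  · have := frequently_map.1 ((frequently_re_neg (diffOneFour z)).filter_mono hm)
    refine this.mono fun w hw => ?_
    rw [h0, diffOneFour_re] at hw
    linarith

/-- `Re L₁ - Re L₄` changes sign at each of its zeros in the right half disk. -/
theorem frequently_of_re_pos {z : ℂ} (hz : ‖z‖ < 1) (hre : 0 < z.re) (h : reL 1 z = reL 4 z) :
    (∃ᶠ w in 𝓝 z, reL 4 w < reL 1 w) ∧ ∃ᶠ w in 𝓝 z, reL 1 w < reL 4 w := by
  rcases lt_trichotomy z.im 0 with him | him | him
  · have h1 := frequently_of_mem_openQuadrant (z := conj z)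
      ⟨by rw [mem_unitDisk]; simpa using hz, by simpa using hre, by simpa using him⟩
      (by rw [reL_one_conj, reL_four_conj, h])
    have hc : Tendsto (fun w => conj w) (𝓝 (conj z)) (𝓝 z) := by
      simpa using (Complex.continuous_conj.tendsto (conj z))
    refine ⟨hc.frequently (h1.1.mono fun w hw => ?_), hc.frequently (h1.2.mono fun w hw => ?_)⟩
      <;> rwa [reL_one_conj, reL_four_conj]
  · exact absurd h (reL_four_lt_one_of_im_eq_zero hz hre him).ne'
  · exact frequently_of_mem_openQuadrant ⟨mem_unitDisk.2 hz, hre, him⟩ h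

/-! ### Comparison of `Re L₁` and `Re L₄` on the imaginary axis -/

/-- `β` is the point at which `f₁(ir)² - f₂(r)²` changes sign on `(0, 1]`. -/
def IsAxisCrossing (β : ℝ) : Prop :=
  0 < β ∧ β < 1 ∧ axisDiff β = 0 ∧
    (∀ r, 0 < r → r < β → 0 < axisDiff r) ∧ (∀ r, β < r → r ≤ 1 → axisDiff r < 0)

theorem neg_sq_of_re_eq_zero {z : ℂ} (h : z.re = 0) : -z ^ 2 = ((‖z‖ ^ 2 : ℝ) : ℂ) := by
  rw [norm_sq_eq, h]
  apply Complex.ext <;> simp [sq, h]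

theorem reL_one_of_re_eq_zero {z : ℂ} (h : z.re = 0) :
    reL 1 z = reL 1 (Complex.I * (‖z‖ : ℝ)) := by
  have hn : ‖z‖ = |z.im| := by
    rw [norm_eq_sqrt_re_im, h, zero_pow two_ne_zero, zero_add, Real.sqrt_sq_eq_abs]
  rcases le_total 0 z.im with h1 | h1
  · rw [hn, abs_of_nonneg h1]
    congr 1
    apply Complex.ext <;> simp [h]
  · rw [hn, abs_of_nonpos h1, ← reL_one_conj z]
    congr 1
    apply Complex.ext <;> simp [h]

theorem axisDiff_norm {z : ℂ} (h : z.re = 0) :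
    axisDiff ‖z‖ = (reL 1 z ^ 2 - reL 4 z ^ 2) / ‖z‖ := by
  rw [axisDiff, ← reL_one, ← reL_one_of_re_eq_zero h, reL_four, neg_sq_of_re_eq_zero h]
  ring

theorem reL_axis {β : ℝ} (hβ : IsAxisCrossing β) {z : ℂ} (h : z.re = 0) (hz0 : z ≠ 0)
    (hz : ‖z‖ ≤ 1) : (‖z‖ < β → reL 4 z < reL 1 z) ∧ (‖z‖ = β → reL 1 z = reL 4 z) ∧
      (β < ‖z‖ → reL 1 z < reL 4 z) := by
  obtain ⟨-, -, h3, h4, h5⟩ := hβ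
  have hn := norm_pos_iff.2 hz0
  have e : axisDiff ‖z‖ * ‖z‖ = reL 1 z ^ 2 - reL 4 z ^ 2 := by
    rw [axisDiff_norm h, div_mul_cancel₀ _ hn.ne']
  refine ⟨fun hb => ?_, fun hb => ?_, fun hb => ?_⟩
  · have := mul_pos (h4 _ hn hb) hn
    exact reL_lt_of_sq_lt (by linarith)
  · rw [hb, h3, zero_mul] at e
    exact (sq_eq_sq₀ (reL_nonneg _ _) (reL_nonneg _ _)).1 (by linarith)
  · have := mul_neg_of_neg_of_pos (h5 _ hb hz) hn
    exact reL_lt_of_sq_lt (by linarith)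

theorem reL_axis_eq_iff {β : ℝ} (hβ : IsAxisCrossing β) {z : ℂ} (h : z.re = 0) (hz0 : z ≠ 0)
    (hz : ‖z‖ ≤ 1) : reL 1 z = reL 4 z ↔ ‖z‖ = β := by
  obtain ⟨h1, h2, h3⟩ := reL_axis hβ h hz0 hz
  refine ⟨fun he => ?_, h2⟩
  rcases lt_trichotomy ‖z‖ β with h4 | h4 | h4
  · exact absurd he (h1 h4).ne'
  · exact h4
  · exact absurd he (h3 h4).ne

theorem reL_axis_le_iff {β : ℝ} (hβ : IsAxisCrossing β) {z : ℂ} (h : z.re = 0) (hz0 : z ≠ 0)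
    (hz : ‖z‖ ≤ 1) : reL 4 z ≤ reL 1 z ↔ ‖z‖ ≤ β := by
  obtain ⟨h1, h2, h3⟩ := reL_axis hβ h hz0 hz
  refine ⟨fun he => ?_, fun he => ?_⟩
  · by_contra! h4
    exact absurd he (not_le.2 (h3 h4))
  · rcases he.lt_or_eq with h4 | h4
    · exact (h1 h4).le
    · exact (h2 h4).ge

theorem rootDilog_eq_iff {β : ℝ} (hβ : IsAxisCrossing β) {r : ℝ} (h0 : 0 < r) (h1 : r ≤ 1) :
    rootDilog 1 (Complex.I * (r : ℂ)) = rootDilog 2 (r : ℂ) ↔ r = β := by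
  have hn : ‖Complex.I * (r : ℂ)‖ = r := by simp [abs_of_pos h0]
  have e1 : rootDilog 1 (Complex.I * (r : ℂ)) = reL 1 (Complex.I * (r : ℂ)) := by
    rw [reL_one, rootDilog]; simp
  have e2 : rootDilog 2 (r : ℂ) = reL 4 (Complex.I * (r : ℂ)) := by
    rw [reL_four, rootDilog]; simp [mul_pow]
  rw [e1, e2, reL_axis_eq_iff hβ (by simp) (norm_pos_iff.1 (by rwa [hn])) (hn.trans_le h1), hn]

/-! ### The phases -/

/-- The set of points of the unit disk at which `Re L_m` is strictly the largest. -/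
def phaseRegion (m : ℕ+) : Set ℂ :=
  {z | z ∈ unitDisk ∧ ∀ k : ℕ+, k ≠ m → reL k z < reL m z}

/-- At the origin all phase functions vanish, so none dominates strictly. -/
theorem ne_zero_of_mem_phaseRegion {m : ℕ+} {z : ℂ} (hz : z ∈ phaseRegion m) : z ≠ 0 := by
  rintro rfl
  have h := hz.2 (m + 1) (by
    intro h
    have := congrArg PNat.val h
    simp at this)
  rw [reL_zero _ (PNat.ne_zero _), reL_zero _ (PNat.ne_zero _)] at h
  exact lt_irrefl _ h

theorem pnat_ne {k m : ℕ+} (h : k ≠ m) : (k : ℕ) ≠ (m : ℕ) := fun h1 => h (PNat.eq h1)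

theorem phaseRegion_one : phaseRegion 1 = {z | z ∈ unitDisk ∧ 0 < z.re ∧ reL 4 z < reL 1 z} := by
  ext z
  refine ⟨fun hz => ⟨hz.1, ?_, hz.2 4 (by decide)⟩, fun ⟨hz, h1, h2⟩ => ⟨hz, fun k hk => ?_⟩⟩
  · exact (reL_two_lt_one_iff (mem_unitDisk.1 hz.1)).1 (hz.2 2 (by decide))
  · rw [mem_unitDisk] at hz
    have hz0 : z ≠ 0 := by rintro rfl; simp at h1
    by_cases k2 : k = 2
    · subst k2; exact reL_two_lt_one hz h1
    by_cases k4 : k = 4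
    · subst k4; exact h2
    exact reL_lt_one hz hz0 h1.le k.ne_zero (pnat_ne hk) (pnat_ne k2) (pnat_ne k4)

theorem phaseRegion_two : phaseRegion 2 = {z | z ∈ unitDisk ∧ z.re < 0 ∧ reL 4 z < reL 2 z} := by
  ext z
  refine ⟨fun hz => ⟨hz.1, ?_, hz.2 4 (by decide)⟩, fun ⟨hz, h1, h2⟩ => ⟨hz, fun k hk => ?_⟩⟩
  · have h1 := hz.2 1 (by decide)
    by_contra! h2
    exact absurd ((reL_two_le_one_iff (mem_unitDisk.1 hz.1)).2 h2) (not_le.2 h1)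
  · rw [mem_unitDisk] at hz
    have hz0 : z ≠ 0 := by rintro rfl; simp at h1
    by_cases k1 : k = 1
    · subst k1; exact reL_one_lt_two hz h1
    by_cases k4 : k = 4
    · subst k4; exact h2
    exact reL_lt_two hz hz0 h1.le k.ne_zero (pnat_ne k1) (pnat_ne hk) (pnat_ne k4)

theorem phaseRegion_four :
    phaseRegion 4 = {z | z ∈ unitDisk ∧ reL 1 z < reL 4 z ∧ reL 2 z < reL 4 z} := by
  ext z
  refine ⟨fun hz => ⟨hz.1, hz.2 1 (by decide), hz.2 2 (by decide)⟩,
    fun ⟨hz, h1, h2⟩ => ⟨hz, fun k hk => ?_⟩⟩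
  rw [mem_unitDisk] at hz
  have hz0 : z ≠ 0 := by
    rintro rfl
    rw [reL_zero 1 (by norm_num), reL_zero 4 (by norm_num)] at h1
    exact lt_irrefl _ h1
  by_cases k1 : k = 1
  · subst k1; exact h1
  by_cases k2 : k = 2
  · subst k2; exact h2
  rcases le_total 0 z.re with h | h
  · exact (reL_lt_one hz hz0 h k.ne_zero (pnat_ne k1) (pnat_ne k2) (pnat_ne hk)).trans h1
  · exact (reL_lt_two hz hz0 h k.ne_zero (pnat_ne k1) (pnat_ne k2) (pnat_ne hk)).trans h2

theorem phaseRegion_eq_empty {m : ℕ+} (h1 : m ≠ 1) (h2 : m ≠ 2) (h4 : m ≠ 4) :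
    phaseRegion m = ∅ := by
  refine eq_empty_of_forall_notMem fun z hz => ?_
  have hz0 := ne_zero_of_mem_phaseRegion hz
  have hz1 := mem_unitDisk.1 hz.1
  rcases le_total 0 z.re with h | h
  · exact lt_asymm (hz.2 1 h1.symm)
      (reL_lt_one hz1 hz0 h m.ne_zero (pnat_ne h1) (pnat_ne h2) (pnat_ne h4))
  · exact lt_asymm (hz.2 2 h2.symm)
      (reL_lt_two hz1 hz0 h m.ne_zero (pnat_ne h1) (pnat_ne h2) (pnat_ne h4))

theorem phaseRegion_two_eq_neg : phaseRegion 2 = -phaseRegion 1 := by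
  rw [phaseRegion_one, phaseRegion_two]
  ext z
  simp [neg_mem_unitDisk, reL_one_neg, reL_four_neg]

theorem neg_phaseRegion_four : -phaseRegion 4 = phaseRegion 4 := by
  rw [phaseRegion_four]
  ext z
  simp [neg_mem_unitDisk, reL_one_neg, reL_two_neg, reL_four_neg, and_comm]

theorem isOpen_lt_of_continuousOn {f g : ℂ → ℝ} (hf : ContinuousOn f unitDisk)
    (hg : ContinuousOn g unitDisk) : IsOpen {z | z ∈ unitDisk ∧ f z < g z} := by
  have := (hg.sub hf).isOpen_inter_preimage isOpen_unitDisk (isOpen_Ioi (a := (0 : ℝ)))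
  convert this using 1
  ext z
  simp

theorem isOpen_reL_four_lt_one : IsOpen {z | z ∈ unitDisk ∧ reL 4 z < reL 1 z} :=
  isOpen_lt_of_continuousOn continuousOn_reL_four continuousOn_reL_one

theorem isOpen_reL_one_lt_four : IsOpen {z | z ∈ unitDisk ∧ reL 1 z < reL 4 z} :=
  isOpen_lt_of_continuousOn continuousOn_reL_one continuousOn_reL_four

theorem isOpen_reL_two_lt_four : IsOpen {z | z ∈ unitDisk ∧ reL 2 z < reL 4 z} :=
  isOpen_lt_of_continuousOn continuousOn_reL_two continuousOn_reL_four

theorem isOpen_phaseRegion_one : IsOpen (phaseRegion 1) := by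
  rw [phaseRegion_one]
  convert isOpen_reL_four_lt_one.inter (isOpen_lt continuous_const Complex.continuous_re)
    using 1
  ext z
  exact ⟨fun h => ⟨⟨h.1, h.2.2⟩, h.2.1⟩, fun h => ⟨h.1.1, h.2, h.1.2⟩⟩

theorem isOpen_phaseRegion_four : IsOpen (phaseRegion 4) := by
  rw [phaseRegion_four]
  convert isOpen_reL_one_lt_four.inter isOpen_reL_two_lt_four using 1
  ext z
  exact ⟨fun h => ⟨⟨h.1, h.2.1⟩, h.1, h.2.2⟩, fun h => ⟨h.1.1, h.1.2, h.2.2⟩⟩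

theorem isOpen_phaseRegion (m : ℕ+) : IsOpen (phaseRegion m) := by
  by_cases h1 : m = 1
  · rw [h1]; exact isOpen_phaseRegion_one
  by_cases h2 : m = 2
  · rw [h2, phaseRegion_two_eq_neg]; exact isOpen_phaseRegion_one.neg
  by_cases h4 : m = 4
  · rw [h4]; exact isOpen_phaseRegion_four
  rw [phaseRegion_eq_empty h1 h2 h4]
  exact isOpen_empty

/-! ### Closures of the phases -/

theorem tendsto_ofReal_mul (z : ℂ) : Tendsto (fun c : ℝ => (c : ℂ) * z) (𝓝 1) (𝓝 z) := by
  have : Continuous fun c : ℝ => (c : ℂ) * z := by fun_prop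
  simpa using this.tendsto 1

theorem tendsto_ofReal_add (z : ℂ) :
    Tendsto (fun c : ℝ => (c : ℂ) + z) (𝓝[>] 0) (𝓝 z) := by
  have : Continuous fun c : ℝ => (c : ℂ) + z := by fun_prop
  simpa using (this.tendsto 0).mono_left nhdsWithin_le_nhds

/-- A small shift to the right leaves the imaginary axis and keeps the open condition `Re L₄ < Re
L₁`. -/
theorem mem_closure_phaseRegion_one_of_lt {z : ℂ} (hz : z ∈ unitDisk) (h : 0 ≤ z.re)
    (h1 : reL 4 z < reL 1 z) : z ∈ closure (phaseRegion 1) := by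
  refine mem_closure_of_tendsto (tendsto_ofReal_add z) ?_
  have h2 := (tendsto_ofReal_add z).eventually (isOpen_reL_four_lt_one.mem_nhds ⟨hz, h1⟩)
  filter_upwards [h2, self_mem_nhdsWithin] with c hc hc0
  rw [phaseRegion_one]
  refine ⟨hc.1, ?_, hc.2⟩
  have : 0 < c := hc0
  simp
  linarith

theorem zero_mem_closure_phaseRegion_one : (0 : ℂ) ∈ closure (phaseRegion 1) := by
  refine mem_closure_of_tendsto (tendsto_ofReal_add 0) ?_
  filter_upwards [self_mem_nhdsWithin, nhdsWithin_le_nhds (Iio_mem_nhds (zero_lt_one' ℝ))]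
    with c hc hc1
  have h0 : 0 < c := hc
  have hn : ‖(c : ℂ)‖ < 1 := by
    rw [Complex.norm_real, Real.norm_of_nonneg h0.le]; exact hc1
  rw [phaseRegion_one, add_zero]
  exact ⟨mem_unitDisk.2 hn, by simpa using h0,
    reL_four_lt_one_of_im_eq_zero hn (by simpa using h0) (by simp)⟩

theorem mem_closure_phaseRegion_one_of_eq {β : ℝ} (hβ : IsAxisCrossing β) {z : ℂ}
    (hz : z ∈ unitDisk) (hz0 : z ≠ 0) (h : 0 ≤ z.re) (h1 : reL 1 z = reL 4 z) :
    z ∈ closure (phaseRegion 1) := by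
  rcases h.lt_or_eq with h0 | h0
  · refine mem_closure_iff_frequently.2 ?_
    have h2 := (frequently_of_re_pos (mem_unitDisk.1 hz) h0 h1).1
    have h3 := (isOpen_unitDisk.inter
      (isOpen_lt continuous_const Complex.continuous_re)).mem_nhds ⟨hz, h0⟩
    rw [phaseRegion_one]
    exact (h2.and_eventually h3).mono fun w hw => ⟨hw.2.1, hw.2.2, hw.1⟩
  · have hn := (reL_axis_eq_iff hβ h0.symm hz0 (mem_unitDisk.1 hz).le).1 h1
    -- Here `z = ± iβ`. Points `c z` with `c < 1` lie on the axis, hence in the closure of the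
    -- region but not in the region itself, so the closure is taken twice.
    rw [← closure_closure]
    refine mem_closure_of_tendsto ((tendsto_ofReal_mul z).mono_left
      (nhdsWithin_le_nhds (s := Iio 1))) ?_
    filter_upwards [self_mem_nhdsWithin, nhdsWithin_le_nhds (Ioi_mem_nhds (zero_lt_one' ℝ))]
      with c hc hc0
    have hc0' : 0 < c := hc0
    have hcn : ‖(c : ℂ) * z‖ < β := by
      rw [norm_mul, Complex.norm_real, Real.norm_of_nonneg hc0'.le, hn]
      exact mul_lt_of_lt_one_left hβ.1 hc
    have hc1 := hcn.trans hβ.2.1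
    have hre : ((c : ℂ) * z).re = 0 := by simp [← h0]
    refine mem_closure_phaseRegion_one_of_lt (mem_unitDisk.2 hc1) hre.ge ?_
    exact (reL_axis hβ hre (mul_ne_zero (by exact_mod_cast hc0'.ne') hz0) hc1.le).1 hcn

theorem mem_closure_phaseRegion_one_iff {β : ℝ} (hβ : IsAxisCrossing β) {z : ℂ}
    (hz : z ∈ unitDisk) : z ∈ closure (phaseRegion 1) ↔ 0 ≤ z.re ∧ reL 4 z ≤ reL 1 z := by
  constructor
  · intro h
    have hsub : phaseRegion 1 ⊆ unitDisk := fun w hw => hw.1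
    rw [phaseRegion_one] at h hsub
    exact ⟨ContinuousWithinAt.closure_le h continuousWithinAt_const
        Complex.continuous_re.continuousWithinAt fun w hw => hw.2.1.le,
      ContinuousWithinAt.closure_le h ((continuousOn_reL_four z hz).mono hsub)
        ((continuousOn_reL_one z hz).mono hsub) fun w hw => hw.2.2.le⟩
  · rintro ⟨h1, h2⟩
    rcases eq_or_ne z 0 with rfl | hz0
    · exact zero_mem_closure_phaseRegion_one
    rcases h2.lt_or_eq with h3 | h3
    · exact mem_closure_phaseRegion_one_of_lt hz h1 h3
    · exact mem_closure_phaseRegion_one_of_eq hβ hz hz0 h1 h3.symm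

theorem mem_closure_phaseRegion_four_of_eq {β : ℝ} (hβ : IsAxisCrossing β) {z : ℂ}
    (hz : z ∈ unitDisk) (hz0 : z ≠ 0) (h : 0 ≤ z.re) (h1 : reL 1 z = reL 4 z) :
    z ∈ closure (phaseRegion 4) := by
  rw [phaseRegion_four]
  rcases h.lt_or_eq with h0 | h0
  · refine mem_closure_iff_frequently.2 ?_
    have h2 := (frequently_of_re_pos (mem_unitDisk.1 hz) h0 h1).2
    have h3 := (isOpen_unitDisk.inter
      (isOpen_lt continuous_const Complex.continuous_re)).mem_nhds ⟨hz, h0⟩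
    exact (h2.and_eventually h3).mono fun w hw =>
      ⟨hw.2.1, hw.1, (reL_two_lt_one (mem_unitDisk.1 hw.2.1) hw.2.2).trans hw.1⟩
  · have hn := (reL_axis_eq_iff hβ h0.symm hz0 (mem_unitDisk.1 hz).le).1 h1
    -- Beyond `± iβ` on the axis `Re L₁ = Re L₂ < Re L₄`, so the points `c z` with `c > 1` lie in
    -- the region itself.
    have ht := (tendsto_ofReal_mul z).mono_left (nhdsWithin_le_nhds (s := Ioi 1))
    refine mem_closure_of_tendsto ht ?_
    filter_upwards [self_mem_nhdsWithin, ht.eventually (isOpen_unitDisk.mem_nhds hz)]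
      with c hc hcd
    have hc1 : 1 < c := hc
    have hc0 : 0 < c := one_pos.trans hc1
    have hcn : β < ‖(c : ℂ) * z‖ := by
      rw [norm_mul, Complex.norm_real, Real.norm_of_nonneg hc0.le, hn]
      exact lt_mul_of_one_lt_left hβ.1 hc1
    have hre : ((c : ℂ) * z).re = 0 := by simp [← h0]
    have h4 := (reL_axis hβ hre (mul_ne_zero (by exact_mod_cast hc0.ne') hz0)
      (mem_unitDisk.1 hcd).le).2.2 hcn
    exact ⟨hcd, h4, reL_one_eq_two hre ▸ h4⟩

/-- The origin satisfies the weak inequalities with equality, yet the disk of radius `1/2` misses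
the region. This is why `γ` leaves the origin out. -/
theorem zero_notMem_closure_phaseRegion_four : (0 : ℂ) ∉ closure (phaseRegion 4) := by
  intro h
  rw [phaseRegion_four] at h
  obtain ⟨w, ⟨hw, h1, h2⟩, hw2⟩ := ((mem_closure_iff_frequently.1 h).and_eventually
    (Metric.ball_mem_nhds (0 : ℂ) one_half_pos)).exists
  rw [dist_zero_right] at hw2
  rcases eq_or_ne w 0 with rfl | hw0
  · rw [reL_zero 1 (by norm_num), reL_zero 4 (by norm_num)] at h1
    exact lt_irrefl _ h1
  rcases le_total 0 w.re with h3 | h3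
  · exact lt_asymm h1 (reL_four_lt_one hw2 hw0 h3)
  · have := reL_four_lt_one (z := -w) (by rwa [norm_neg]) (neg_ne_zero.2 hw0) (by simpa using h3)
    rw [reL_one_neg, reL_four_neg] at this
    exact lt_asymm h2 this

theorem mem_closure_phaseRegion_four_iff {β : ℝ} (hβ : IsAxisCrossing β) {z : ℂ}
    (hz : z ∈ unitDisk) :
    z ∈ closure (phaseRegion 4) ↔ z ≠ 0 ∧ reL 1 z ≤ reL 4 z ∧ reL 2 z ≤ reL 4 z := by
  constructor
  · intro h
    have hz0 : z ≠ 0 := by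
      rintro rfl
      exact zero_notMem_closure_phaseRegion_four h
    have hsub : phaseRegion 4 ⊆ unitDisk := fun w hw => hw.1
    rw [phaseRegion_four] at h hsub
    exact ⟨hz0, ContinuousWithinAt.closure_le h ((continuousOn_reL_one z hz).mono hsub)
        ((continuousOn_reL_four z hz).mono hsub) fun w hw => hw.2.1.le,
      ContinuousWithinAt.closure_le h ((continuousOn_reL_two z hz).mono hsub)
        ((continuousOn_reL_four z hz).mono hsub) fun w hw => hw.2.2.le⟩
  · rintro ⟨hz0, h1, h2⟩
    have hn := mem_unitDisk.1 hz
    rcases h1.lt_or_eq with h3 | h3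
    · rcases h2.lt_or_eq with h4 | h4
      · refine subset_closure ?_
        rw [phaseRegion_four]
        exact ⟨hz, h3, h4⟩
      · have h5 : z.re ≤ 0 := by
          by_contra! h6
          exact absurd (reL_two_lt_one hn h6) (by linarith)
        have := mem_closure_phaseRegion_four_of_eq hβ (z := -z) (neg_mem_unitDisk.2 hz)
          (neg_ne_zero.2 hz0) (by simpa using h5) (by rw [reL_one_neg, reL_four_neg, h4])
        rwa [← neg_phaseRegion_four, ← neg_closure, Set.neg_mem_neg] at this
    · have h5 : 0 ≤ z.re := (reL_two_le_one_iff hn).1 (h2.trans h3.ge)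
      exact mem_closure_phaseRegion_four_of_eq hβ hz hz0 h5 h3

/-! ### The maximal family -/

theorem mem_closure_of_re_nonneg {β : ℝ} (hβ : IsAxisCrossing β) {z : ℂ} (hz : z ∈ unitDisk)
    (h : 0 ≤ z.re) : z ∈ closure (phaseRegion 1) ∨ z ∈ closure (phaseRegion 4) := by
  rcases le_or_gt (reL 4 z) (reL 1 z) with h1 | h1
  · exact Or.inl ((mem_closure_phaseRegion_one_iff hβ hz).2 ⟨h, h1⟩)
  · refine Or.inr (subset_closure ?_)
    rw [phaseRegion_four]
    exact ⟨hz, h1, ((reL_two_le_one_iff (mem_unitDisk.1 hz)).2 h).trans_lt h1⟩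

theorem nonempty_phaseRegion_one : (phaseRegion 1).Nonempty :=
  closure_nonempty_iff.1 ⟨0, zero_mem_closure_phaseRegion_one⟩

theorem nonempty_phaseRegion_four {β : ℝ} (hβ : IsAxisCrossing β) :
    (phaseRegion 4).Nonempty := by
  have hn : ‖Complex.I * (β : ℂ)‖ = β := by simp [abs_of_pos hβ.1]
  have hz : Complex.I * (β : ℂ) ∈ unitDisk := mem_unitDisk.2 (hn.trans_lt hβ.2.1)
  have hz0 : Complex.I * (β : ℂ) ≠ 0 := norm_pos_iff.1 (hn.symm ▸ hβ.1)
  exact closure_nonempty_iff.1 ⟨_, mem_closure_phaseRegion_four_of_eq hβ hz hz0 (by simp)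
    ((reL_axis_eq_iff hβ (by simp) hz0 (mem_unitDisk.1 hz).le).2 hn)⟩

theorem setOf_nonempty_phaseRegion {β : ℝ} (hβ : IsAxisCrossing β) :
    {m : ℕ+ | (phaseRegion m).Nonempty} = {1, 2, 4} := by
  ext m
  constructor
  · intro h
    by_contra h'
    simp only [mem_insert_iff, mem_singleton_iff, not_or] at h'
    have h1 : (phaseRegion m).Nonempty := h
    rw [phaseRegion_eq_empty h'.1 h'.2.1 h'.2.2] at h1
    exact not_nonempty_empty h1
  · rintro (rfl | rfl | rfl)
    · exact nonempty_phaseRegion_one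
    · change (phaseRegion 2).Nonempty
      rw [phaseRegion_two_eq_neg]
      exact nonempty_phaseRegion_one.neg
    · exact nonempty_phaseRegion_four hβ

theorem isPhaseDecomposition_phaseRegion {β : ℝ} (hβ : IsAxisCrossing β) :
    IsPhaseDecomposition unitDisk (fun k : ℕ+ => oddL (k : ℕ)) phaseRegion where
  isOpen := isOpen_phaseRegion
  subset m z hz := hz.1
  disjoint m k h := Set.disjoint_left.2 fun z h1 h2 =>
    lt_asymm (h1.2 k h.symm) (h2.2 m h)
  finite := by
    rw [setOf_nonempty_phaseRegion hβ]
    exact Set.toFinite _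
  cover z hz := by
    rw [mem_iUnion]
    rcases le_total 0 z.re with h | h
    · rcases mem_closure_of_re_nonneg hβ hz h with h1 | h1
      · exact ⟨_, h1⟩
      · exact ⟨_, h1⟩
    · rcases mem_closure_of_re_nonneg hβ (neg_mem_unitDisk.2 hz) (by simpa using h) with h1 | h1
      · refine ⟨2, ?_⟩
        rwa [phaseRegion_two_eq_neg, ← neg_closure, Set.mem_neg]
      · refine ⟨4, ?_⟩
        rwa [← neg_phaseRegion_four, ← neg_closure, Set.mem_neg]
  dominant m z hz k h := hz.2 k h

theorem IsPhaseDecomposition.le_phaseRegion {R : ℕ+ → Set ℂ}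
    (h : IsPhaseDecomposition unitDisk (fun k : ℕ+ => oddL (k : ℕ)) R) : R ≤ phaseRegion :=
  fun m z hz => ⟨h.subset m hz, fun k hk => h.dominant m z hz k hk⟩

/-- A decomposition that contains all others is the greatest one, hence the only maximal one. -/
theorem isPhaseFamily_iff {β : ℝ} (hβ : IsAxisCrossing β) (R : ℕ+ → Set ℂ) :
    IsPhaseFamily unitDisk (fun k : ℕ+ => oddL (k : ℕ)) R ↔ R = phaseRegion := by
  have h0 := isPhaseDecomposition_phaseRegion hβ
  constructor
  · intro h
    exact le_antisymm h.1.le_phaseRegion (h.2 h0 h.1.le_phaseRegion)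
  · rintro rfl
    exact ⟨h0, fun R' h _ => h.le_phaseRegion⟩

/-! ### The boundaries of the phases -/

theorem mem_gammaCurve_union_conj {z : ℂ} : z ∈ gammaCurve ∪ conj '' gammaCurve ↔
    z ∈ unitDisk ∧ z ≠ 0 ∧ 0 ≤ z.re ∧ reL 1 z = reL 4 z := by
  have hc : z ∈ conj '' gammaCurve ↔ conj z ∈ gammaCurve :=
    ⟨by rintro ⟨w, hw, rfl⟩; rwa [Complex.conj_conj], fun h => ⟨conj z, h, Complex.conj_conj z⟩⟩
  have hd : conj z ∈ unitDisk ↔ z ∈ unitDisk := by simp [mem_unitDisk]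
  have h1 : z ∈ gammaCurve ↔
      z ∈ unitDisk ∧ z ≠ 0 ∧ 0 ≤ z.re ∧ 0 ≤ z.im ∧ reL 1 z = reL 4 z := Iff.rfl
  have h2 : conj z ∈ gammaCurve ↔
      z ∈ unitDisk ∧ z ≠ 0 ∧ 0 ≤ z.re ∧ 0 ≤ -z.im ∧ reL 1 z = reL 4 z := by
    rw [← hd, ← reL_one_conj z, ← reL_four_conj z, ← Complex.conj_im, ← Complex.conj_re z,
      ← (map_ne_zero (starRingEnd ℂ) : conj z ≠ 0 ↔ z ≠ 0)]
    rfl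
  rw [mem_union, hc, h1, h2]
  rcases le_total 0 z.im with h | h
  · have : 0 ≤ -z.im → 0 ≤ z.im := fun _ => h
    tauto
  · have : 0 ≤ -z.im := by linarith
    tauto

theorem mem_imagSegment {β : ℝ} {z : ℂ} : z ∈ imagSegment β ↔ z.re = 0 ∧ ‖z‖ ≤ β := by
  constructor
  · rintro ⟨t, ht, rfl⟩
    refine ⟨by simp, ?_⟩
    simpa using abs_le.2 ht
  · rintro ⟨h, hn⟩
    refine ⟨z.im, ?_, ?_⟩
    · exact abs_le.1 ((Complex.abs_im_le_norm z).trans hn)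
    · apply Complex.ext <;> simp [h]

theorem mem_frontier_phaseRegion {m : ℕ+} {z : ℂ} :
    z ∈ frontier (phaseRegion m) ↔ z ∈ closure (phaseRegion m) ∧ z ∉ phaseRegion m := by
  rw [(isOpen_phaseRegion m).frontier_eq, Set.mem_sdiff]

/-- The region is open, so its frontier is the closure minus the region: points with `Re z > 0` must
satisfy `Re L₁ = Re L₄`, while on the axis `Re L₄ ≤ Re L₁` means `|z| ≤ β`. The points `± iβ` belong
to both pieces. -/
theorem frontier_phaseRegion_one {β : ℝ} (hβ : IsAxisCrossing β) :
    frontier (phaseRegion 1) ∩ unitDisk = imagSegment β ∪ gammaCurve ∪ conj '' gammaCurve := by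
  ext z
  rw [union_assoc, mem_union, mem_gammaCurve_union_conj, mem_inter_iff, mem_imagSegment,
    mem_frontier_phaseRegion]
  constructor
  · rintro ⟨⟨h1, h2⟩, hz⟩
    rw [mem_closure_phaseRegion_one_iff hβ hz] at h1
    rw [phaseRegion_one] at h2
    rcases eq_or_ne z 0 with rfl | hz0
    · exact Or.inl ⟨by simp, by simpa using hβ.1.le⟩
    rcases h1.1.lt_or_eq with h3 | h3
    · exact Or.inr ⟨hz, hz0, h1.1, le_antisymm (not_lt.1 fun h4 => h2 ⟨hz, h3, h4⟩) h1.2⟩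
    · exact Or.inl ⟨h3.symm, (reL_axis_le_iff hβ h3.symm hz0 (mem_unitDisk.1 hz).le).1 h1.2⟩
  · rintro (⟨h1, h2⟩ | ⟨hz, hz0, h1, h2⟩)
    · have hz : z ∈ unitDisk := mem_unitDisk.2 (h2.trans_lt hβ.2.1)
      refine ⟨⟨?_, ?_⟩, hz⟩
      · rcases eq_or_ne z 0 with rfl | hz0
        · exact zero_mem_closure_phaseRegion_one
        exact (mem_closure_phaseRegion_one_iff hβ hz).2
          ⟨h1.ge, (reL_axis_le_iff hβ h1 hz0 (mem_unitDisk.1 hz).le).2 h2⟩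
      · rw [phaseRegion_one]
        exact fun h => h.2.1.ne' h1
    · refine ⟨⟨mem_closure_phaseRegion_one_of_eq hβ hz hz0 h1 h2, ?_⟩, hz⟩
      rw [phaseRegion_one]
      exact fun h => h.2.2.ne' h2

theorem frontier_phaseRegion_two {β : ℝ} (hβ : IsAxisCrossing β) :
    frontier (phaseRegion 2) ∩ unitDisk =
      imagSegment β ∪ -gammaCurve ∪ -(conj '' gammaCurve) := by
  have h1 : frontier (phaseRegion 2) = -frontier (phaseRegion 1) := by
    rw [phaseRegion_two_eq_neg]
    exact ((Homeomorph.neg ℂ).preimage_frontier (phaseRegion 1)).symm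
  have h2 : -unitDisk = unitDisk := by ext z; exact neg_mem_unitDisk
  have h3 : -imagSegment β = imagSegment β := by
    ext z
    rw [Set.mem_neg, mem_imagSegment, mem_imagSegment, norm_neg, Complex.neg_re, neg_eq_zero]
  rw [h1, ← h2, ← Set.inter_neg, frontier_phaseRegion_one hβ, Set.union_neg, Set.union_neg, h3]

theorem frontier_phaseRegion_four {β : ℝ} (hβ : IsAxisCrossing β) :
    frontier (phaseRegion 4) ∩ unitDisk =
      gammaCurve ∪ -gammaCurve ∪ conj '' gammaCurve ∪ -(conj '' gammaCurve) := by
  have hset : gammaCurve ∪ -gammaCurve ∪ conj '' gammaCurve ∪ -(conj '' gammaCurve) =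
      (gammaCurve ∪ conj '' gammaCurve) ∪ -(gammaCurve ∪ conj '' gammaCurve) := by
    rw [Set.union_neg]
    ac_rfl
  rw [hset]
  ext z
  rw [mem_union, Set.mem_neg, mem_gammaCurve_union_conj, mem_gammaCurve_union_conj,
    mem_inter_iff, mem_frontier_phaseRegion, neg_mem_unitDisk, reL_one_neg, reL_four_neg,
    neg_ne_zero, Complex.neg_re, neg_nonneg]
  constructor
  · rintro ⟨⟨h1, h2⟩, hz⟩
    have hn := mem_unitDisk.1 hz
    obtain ⟨hz0, h3, h4⟩ := (mem_closure_phaseRegion_four_iff hβ hz).1 h1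
    rw [phaseRegion_four] at h2
    rcases h3.lt_or_eq with h5 | h5
    · have h6 : reL 2 z = reL 4 z := le_antisymm h4 (not_lt.1 fun h => h2 ⟨hz, h5, h⟩)
      refine Or.inr ⟨hz, hz0, ?_, h6⟩
      by_contra! h7
      exact absurd (reL_two_lt_one hn h7) (by linarith)
    · exact Or.inl ⟨hz, hz0, (reL_two_le_one_iff hn).1 (h4.trans h5.ge), h5⟩
  · rintro (⟨hz, hz0, h1, h2⟩ | ⟨hz, hz0, h1, h2⟩)
    · refine ⟨⟨mem_closure_phaseRegion_four_of_eq hβ hz hz0 h1 h2, ?_⟩, hz⟩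
      rw [phaseRegion_four]
      exact fun h => h.2.1.ne h2
    · refine ⟨⟨?_, ?_⟩, hz⟩
      · have := mem_closure_phaseRegion_four_of_eq hβ (z := -z) (neg_mem_unitDisk.2 hz)
          (neg_ne_zero.2 hz0) (by simpa using h1) (by rw [reL_one_neg, reL_four_neg, h2])
        rwa [← neg_phaseRegion_four, ← neg_closure, Set.neg_mem_neg] at this
      · rw [phaseRegion_four]
        exact fun h => h.2.2.ne h2

end OddPartitionPhases

theorem mainTheorem6 :
    (∀ h k : ℕ, 1 ≤ h → h ≤ k → Nat.Coprime h k → ∀ z ∈ OddPartitionPhases.unitDisk,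
      ((Real.sqrt 2 : ℝ) : ℂ) *
          OddPartitionPhases.phaseFunction OddPartitionPhases.oddExponent h k z =
        OddPartitionPhases.oddL k z) ∧
    ∃ β : ℝ, 0 < β ∧ β < 1 ∧
      (∀ r : ℝ, 0 < r → r ≤ 1 →
        (OddPartitionPhases.rootDilog 1 (Complex.I * (r : ℂ)) =
          OddPartitionPhases.rootDilog 2 (r : ℂ) ↔ r = β)) ∧
      ∃ R : ℕ+ → Set ℂ,
        (∀ R' : ℕ+ → Set ℂ,
          OddPartitionPhases.IsPhaseFamily OddPartitionPhases.unitDisk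
            (fun k : ℕ+ => OddPartitionPhases.oddL (k : ℕ)) R' ↔ R' = R) ∧
        {m : ℕ+ | (R m).Nonempty} = {1, 2, 4} ∧
        frontier (R 4) ∩ OddPartitionPhases.unitDisk =
          OddPartitionPhases.gammaCurve ∪ -OddPartitionPhases.gammaCurve ∪
            conj '' OddPartitionPhases.gammaCurve ∪
            -(conj '' OddPartitionPhases.gammaCurve) ∧
        frontier (R 1) ∩ OddPartitionPhases.unitDisk =
          OddPartitionPhases.imagSegment β ∪ OddPartitionPhases.gammaCurve ∪
            conj '' OddPartitionPhases.gammaCurve ∧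
        frontier (R 2) ∩ OddPartitionPhases.unitDisk =
          OddPartitionPhases.imagSegment β ∪ -OddPartitionPhases.gammaCurve ∪
            -(conj '' OddPartitionPhases.gammaCurve) := by
  obtain ⟨β, hβ⟩ := OddPartitionPhases.exists_axisDiff_sign
  exact ⟨fun h k h1 h2 h3 z hz => OddPartitionPhases.sqrt_two_mul_phaseFunction h1 h2 h3
      (OddPartitionPhases.mem_unitDisk.1 hz).le, β, hβ.1, hβ.2.1,
    fun r h0 h1 => OddPartitionPhases.rootDilog_eq_iff hβ h0 h1,
    OddPartitionPhases.phaseRegion, OddPartitionPhases.isPhaseFamily_iff hβ,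
    OddPartitionPhases.setOf_nonempty_phaseRegion hβ,
    OddPartitionPhases.frontier_phaseRegion_four hβ,
    OddPartitionPhases.frontier_phaseRegion_one hβ,
    OddPartitionPhases.frontier_phaseRegion_two hβ⟩
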